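/- A set of positions of a matrix is independent if no two of them lie in the same row or column. An \emph{exponential RAP} (random assignment problem) $P$ with parameters $k\le\min(m,n)$ is an $m\times n$ matrix whose entries are linear combinations, with nonnegative rational coefficients, of finitely many independent exponentially distributed random variables $X_1,\dots,X_p$; $E(P)$ denotes the expected value of the minimal sum of the entries in an independent set of $k$ positions. A position is \emph{standard} if its entry is a single variable $X_i$ of intensity $1$ that occurs in no other position. A \emph{zero} is a position whose coefficients all vanish. An optimal cover of the zeros is a set of rows and columns of minimal cardinality that together contain all zeros; the column-maximal one is the optimal cover that contains every column belonging to some optimal cover. A linear function $f(x)=ax+b$ with real coefficients is \emph{$k$-positive} if $f(x)>0$ for all real $x\ge k$. An \emph{RAP-sequence} is a sequence $(P_n)_{n\ge n_0}$ of exponential RAP's with common $m$ and $k$ such that: $P_n$ has $n$ columns and is given in independent exponential variables $X_{n,1},\dots,X_{n,p(n)}$; in each position in the first $n_0$ columns and for each $i$, the coefficient of $X_{n,i}$ in $P_n$ equals the coefficient of $X_{n_0,i}$ in $P_{n_0}$ (coefficients of non-existent variables being $0$); and all positions of $P_n$ beyond column $n_0$ are standard. It is \emph{well-behaved} if (i)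 for each $i$ such that the variables $X_{n,i}$ occur in the first $n_0$ columns there is a $k$-positive linear function $f_i$ such that $X_{n,i}$ has intensity $f_i(n)$ for all $n\ge n_0$; and (ii) for every $n\ge n_0$, every nonzero entry of $P_n$ in a nonstandard position lies in a column of the column-maximal optimal cover of the zeros of $P_n$. \textbf{Theorem (Rationality Theorem).} Let $(P_n)_{n\ge n_0}$ be a well-behaved RAP-sequence with parameters $m$ and $k$. Then there is a rational function $f$ in one variable with real coefficients such that 1. every complex zero of the denominator of $f$ (in lowest terms) is real and less than $k$; 2. for every $n\ge n_0$, the expectation $E(P_n)$ is finite and $E(P_n)=f(n)$. -/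

import Mathlib

open MeasureTheory ProbabilityTheory

noncomputable section

/-- A `k`-assignment in an `m × n` matrix: a set of `k` positions, no two of them in the same row
or in the same column. -/
def IsAssignment {m n : ℕ} (k : ℕ) (s : Finset (Fin m × Fin n)) : Prop :=
  s.card = k ∧ ∀ e ∈ s, ∀ e' ∈ s, e ≠ e' → e.1 ≠ e'.1 ∧ e.2 ≠ e'.2

/-- The minimal sum of the entries of a `k`-assignment. There are finitely many `k`-assignments, and
at least one if `k ≤ min m n`, so that the infimum is then a minimum. -/
def minAssignmentSum {m n : ℕ} (k : ℕ) (A : Fin m → Fin n → ℝ) : ℝ :=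
  ⨅ s : {s : Finset (Fin m × Fin n) // IsAssignment k s}, ∑ e ∈ s.1, A e.1 e.2

/-- The rows `R` and the columns `C` cover the set `Z` of matrix positions. -/
def IsCover {m n : ℕ} (Z : Set (Fin m × Fin n)) (R : Finset (Fin m)) (C : Finset (Fin n)) : Prop :=
  ∀ e ∈ Z, e.1 ∈ R ∨ e.2 ∈ C

/-- A cover with the minimal number of rows and columns. -/
def IsOptimalCover {m n : ℕ} (Z : Set (Fin m × Fin n)) (R : Finset (Fin m))
    (C : Finset (Fin n)) : Prop :=
  IsCover Z R C ∧ ∀ R' C', IsCover Z R' C' → R.card + C.card ≤ R'.card + C'.card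

/-- The column-maximal optimal cover: the optimal cover that contains every column belonging to
some optimal cover. -/
def IsColumnMaximalOptimalCover {m n : ℕ} (Z : Set (Fin m × Fin n)) (R : Finset (Fin m))
    (C : Finset (Fin n)) : Prop :=
  IsOptimalCover Z R C ∧ ∀ R' C', IsOptimalCover Z R' C' → C' ⊆ C

/-- An exponential random assignment problem on the probability space `(Ω, μ)`: a number
`k ≤ min m n` and an `m × n` matrix whose entries are linear combinations, with nonnegative rational
coefficients, of independent exponentially distributed random variables `X 0, …, X (p - 1)`. -/
structure ExponentialRAP (k m n : ℕ) {Ω : Type*} [MeasurableSpace Ω] (μ : Measure Ω) where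
  k_le_m : k ≤ m
  k_le_n : k ≤ n
  p : ℕ
  X : Fin p → Ω → ℝ
  intensity : Fin p → ℝ
  intensity_pos : ∀ l, 0 < intensity l
  hasLaw : ∀ l, HasLaw (X l) (expMeasure (intensity l)) μ
  indep : iIndepFun X μ
  coeff : Fin m → Fin n → Fin p → ℚ≥0

namespace ExponentialRAP

variable {k m n : ℕ} {Ω : Type*} [MeasurableSpace Ω] {μ : Measure Ω}

/-- The matrix of random variables. -/
def entry (P : ExponentialRAP k m n μ) (i : Fin m) (j : Fin n) (ω : Ω) : ℝ :=
  ∑ l, ((P.coeff i j l : ℚ) : ℝ) * P.X l ω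

/-- The minimal sum of an independent set of `k` matrix elements, as a random variable. -/
def cost (P : ExponentialRAP k m n μ) (ω : Ω) : ℝ :=
  minAssignmentSum k (fun i j => P.entry i j ω)

/-- `E(P)`, the expected value of the minimal sum of an independent set of `k` matrix elements. -/
def expectedCost (P : ExponentialRAP k m n μ) : ℝ :=
  ∫ ω, P.cost ω ∂μ

/-- The coefficient of the variable with index `l`, which is zero if there is no such variable. -/
def coeffAt (P : ExponentialRAP k m n μ) (i : Fin m) (j : Fin n) (l : ℕ) : ℚ≥0 :=
  if h : l < P.p then P.coeff i j ⟨l, h⟩ else 0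

/-- The set of positions of the zero entries. -/
def zeros (P : ExponentialRAP k m n μ) : Set (Fin m × Fin n) :=
  {e | ∀ l, P.coeff e.1 e.2 l = 0}

/-- The position `(i, j)` is standard: its entry is a single variable of intensity 1 (with
coefficient 1), and this variable occurs in no other position. -/
def IsStandardPosition (P : ExponentialRAP k m n μ) (i : Fin m) (j : Fin n) : Prop :=
  ∃ l, P.intensity l = 1 ∧ P.coeff i j l = 1 ∧ (∀ l', l' ≠ l → P.coeff i j l' = 0) ∧
    ∀ i' j', P.coeff i' j' l ≠ 0 → i' = i ∧ j' = j

end ExponentialRAP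

/-- A linear function `x ↦ a x + b` is `k`-positive if it is positive for all `x ≥ k`. -/
def IsKPositive (k : ℕ) (f : ℝ → ℝ) : Prop :=
  (∃ a b : ℝ, ∀ x, f x = a * x + b) ∧ ∀ x : ℝ, (k : ℝ) ≤ x → 0 < f x

/-- An RAP-sequence `P n`, `n ≥ n₀`, of exponential RAP's with the same `k` and `m`, where `P n` has
`n` columns. -/
structure RAPSequence (k m n₀ : ℕ) {Ω : ℕ → Type*} [∀ n, MeasurableSpace (Ω n)]
    (μ : ∀ n, Measure (Ω n)) where
  P : ∀ n, n₀ ≤ n → ExponentialRAP k m n (μ n)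
  coeff_eq : ∀ n (h : n₀ ≤ n) (i : Fin m) (j : Fin n₀) (l : ℕ),
    (P n h).coeffAt i (Fin.castLE h j) l = (P n₀ le_rfl).coeffAt i j l
  standard_beyond : ∀ n (h : n₀ ≤ n) (i : Fin m) (j : Fin n), n₀ ≤ (j : ℕ) →
    (P n h).IsStandardPosition i j

/-- A well-behaved RAP-sequence. -/
structure RAPSequence.WellBehaved {k m n₀ : ℕ} {Ω : ℕ → Type*} [∀ n, MeasurableSpace (Ω n)]
    {μ : ∀ n, Measure (Ω n)} (S : RAPSequence k m n₀ μ) : Prop where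
  /-- The intensity of a variable that occurs in the first `n₀` columns is a `k`-positive linear
  function of `n`. -/
  intensity_linear : ∀ l : ℕ, (∃ i j, (S.P n₀ le_rfl).coeffAt i j l ≠ 0) →
    ∃ f : ℝ → ℝ, IsKPositive k f ∧
      ∀ n (h : n₀ ≤ n) (hl : l < (S.P n h).p), (S.P n h).intensity ⟨l, hl⟩ = f n
  /-- The column of a nonzero nonstandard entry belongs to the column-maximal optimal cover of the
  zeros. -/
  nonstandard_covered : ∀ n (h : n₀ ≤ n) (i : Fin m) (j : Fin n),
    (i, j) ∉ (S.P n h).zeros → ¬ (S.P n h).IsStandardPosition i j →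
      ∃ R C, IsColumnMaximalOptimalCover (S.P n h).zeros R C ∧ j ∈ C

end

open scoped ENNReal

/-!
The proof runs the dual step of the Hungarian algorithm on exponential variables. A state consists
of a set of independent zeros and of the rows that alternating paths reach from it; the reached rows
and the columns matched to unreached rows cover these zeros. Let `t` be the minimum of the uncovered
standard variables and of a set `O` of further variables. Subtracting `t` from the uncovered entries
and adding it to the doubly covered ones lowers the minimal sum by a fixed multiple of `t`, and by
memorylessness the remainders are again independent exponential variables. The rate of `t` is a
linear function of the number `n` of columns that is positive for `n ≥ k`, and so are the rates of
the variables in `O`. Hence the mean cost is a sum of terms with coefficients rational in `n` whose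
poles are less than `k`. The standard variables beyond column `n₀` are exchangeable and together
contribute one term with the factor `n - n₀`.

A step whose minimal variable is standard creates an uncovered zero, which makes one more row
reached or augments the matching. For uncovered entries that are not standard, first make any two
of them comparable coefficientwise, by rescaling variables and conditioning on which of two is the
smaller; then rescale a variable of the least entry so that its coefficient there is `1`. Taking
this variable as `O`, the step either creates an uncovered zero or removes the variable from the
least entry.
-/

section Exponential

theorem measurable_exponentialPDF (r : ℝ) : Measurable (exponentialPDF r) :=
  (measurable_exponentialPDFReal r).ennreal_ofReal

theorem expMeasure_eq_withDensity (r : ℝ) :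
    expMeasure r = volume.withDensity (exponentialPDF r) :=
  rfl

instance sigmaFinite_expMeasure (r : ℝ) : SigmaFinite (expMeasure r) :=
  SigmaFinite.withDensity_ofReal _

instance nullSingletonClass_expMeasure (r : ℝ) : NullSingletonClass (expMeasure r) :=
  ⟨fun x => withDensity_absolutelyContinuous volume (exponentialPDF r) (measure_singleton x)⟩

theorem ae_nonneg_expMeasure (r : ℝ) : ∀ᵐ x ∂expMeasure r, 0 ≤ x := by
  rw [expMeasure_eq_withDensity, ae_withDensity_iff (measurable_exponentialPDF r)]
  refine Filter.Eventually.of_forall fun x hx => ?_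
  contrapose! hx
  exact exponentialPDF_of_neg hx

theorem map_mul_left_expMeasure {r a : ℝ} (hr : 0 < r) (ha : 0 < a) :
    (expMeasure r).map (a * ·) = expMeasure (r / a) := by
  have := isProbabilityMeasure_expMeasure hr
  have := isProbabilityMeasure_expMeasure (div_pos hr ha)
  have : IsProbabilityMeasure ((expMeasure r).map (a * ·)) :=
    Measure.isProbabilityMeasure_map (by fun_prop)
  refine Measure.eq_of_cdf _ _ ?_
  ext x
  have hpre : (a * ·) ⁻¹' Set.Iic x = Set.Iic (x / a) := by
    ext y
    simp [le_div_iff₀' ha]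
  have hsign : 0 ≤ x / a ↔ 0 ≤ x := by rw [le_div_iff₀ ha, zero_mul]
  rw [cdf_eq_real, map_measureReal_apply (by fun_prop) measurableSet_Iic, hpre, ← cdf_eq_real,
    cdf_expMeasure_eq hr, cdf_expMeasure_eq (div_pos hr ha)]
  simp only [hsign, mul_div_assoc', div_mul_eq_mul_div]

theorem lintegral_ofReal_expMeasure {r : ℝ} (hr : 0 < r) :
    ∫⁻ x, ENNReal.ofReal x ∂expMeasure r = ENNReal.ofReal (1 / r) := by
  have := isProbabilityMeasure_expMeasure hr
  have htail : ∀ t ∈ Set.Ioi (0 : ℝ),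
      expMeasure r {x | t < x} = ENNReal.ofReal (Real.exp (-r * t)) := by
    intro t ht
    change expMeasure r (Set.Ioi t) = _
    rw [← ofReal_measureReal, ← Set.compl_Iic, probReal_compl_eq_one_sub measurableSet_Iic,
      ← cdf_eq_real, cdf_expMeasure_eq hr, if_pos (Set.mem_Ioi.1 ht).le]
    simp
  rw [lintegral_eq_lintegral_meas_lt _ (ae_nonneg_expMeasure r) aemeasurable_id,
    setLIntegral_congr_fun measurableSet_Ioi htail,
    ← ofReal_integral_eq_lintegral_ofReal
      (by simpa only [neg_mul, IntegrableOn] using exp_neg_integrableOn_Ioi 0 hr)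
      (Filter.Eventually.of_forall fun t => (Real.exp_pos _).le),
    integral_exp_mul_Ioi (neg_neg_of_pos hr)]
  simp

theorem measurePreserving_withDensity_comp {α β : Type*} [MeasurableSpace α] [MeasurableSpace β]
    {μ : Measure α} {ν : Measure β} {e : α ≃ᵐ β} (he : MeasurePreserving e μ ν) (f : β → ℝ≥0∞) :
    MeasurePreserving e (μ.withDensity fun x => f (e x)) (ν.withDensity f) := by
  refine ⟨e.measurable, Measure.ext fun s hs => ?_⟩
  rw [e.map_apply, withDensity_apply _ (e.measurable hs), withDensity_apply _ hs,
    he.setLIntegral_comp_preimage_emb e.measurableEmbedding]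

theorem exponentialPDF_mul_exponentialPDF_of_le {a b x y : ℝ} (ha : 0 < a) (hb : 0 < b)
    (hxy : x ≤ y) : exponentialPDF a x * exponentialPDF b y =
      ENNReal.ofReal (a / (a + b)) * (exponentialPDF (a + b) x * exponentialPDF b (y - x)) := by
  rcases lt_or_ge x 0 with hx | hx
  · simp [exponentialPDF_of_neg hx]
  · rw [exponentialPDF_of_nonneg hx, exponentialPDF_of_nonneg hx,
      exponentialPDF_of_nonneg (hx.trans hxy), exponentialPDF_of_nonneg (sub_nonneg.2 hxy),
      ← ENNReal.ofReal_mul (by positivity), ← ENNReal.ofReal_mul (by positivity),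
      ← ENNReal.ofReal_mul (by positivity)]
    congr 1
    have hexp : Real.exp (-((a + b) * x)) * Real.exp (-(b * (y - x))) =
        Real.exp (-(a * x)) * Real.exp (-(b * y)) := by
      rw [← Real.exp_add, ← Real.exp_add]
      ring_nf
    rw [mul_mul_mul_comm, ← hexp]
    field_simp

theorem prod_expMeasure_restrict_le {a b : ℝ} (ha : 0 < a) (hb : 0 < b) :
    ((expMeasure a).prod (expMeasure b)).restrict {p | p.1 ≤ p.2} =
      ENNReal.ofReal (a / (a + b)) •
        ((expMeasure (a + b)).prod (expMeasure b)).map fun p => (p.1, p.1 + p.2) := by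
  have hle : MeasurableSet {p : ℝ × ℝ | p.1 ≤ p.2} := measurableSet_le measurable_fst measurable_snd
  have hpdf := measurable_exponentialPDF
  let density : ℝ × ℝ → ℝ≥0∞ := fun p => exponentialPDF (a + b) p.1 * exponentialPDF b (p.2 - p.1)
  have hshear : MeasurePreserving (fun p : ℝ × ℝ => (p.1, p.1 + p.2))
      ((expMeasure (a + b)).prod (expMeasure b)) (volume.withDensity density) := by
    convert! measurePreserving_withDensity_comp (e := MeasurableEquiv.shearAddRight ℝ)
      (measurePreserving_prod_add volume volume) density using 1
    rw [expMeasure_eq_withDensity, expMeasure_eq_withDensity, prod_withDensity (hpdf _) (hpdf _)]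
    simp [density, MeasurableEquiv.shearAddRight]
  rw [hshear.map_eq, expMeasure_eq_withDensity, expMeasure_eq_withDensity,
    prod_withDensity (hpdf _) (hpdf _), restrict_withDensity hle, ← withDensity_indicator hle,
    ← withDensity_smul _ (by fun_prop), Measure.volume_eq_prod]
  congr 1
  ext p
  by_cases hp : p.1 ≤ p.2
  · rw [Set.indicator_of_mem (by exact hp), exponentialPDF_mul_exponentialPDF_of_le ha hb hp]
    rfl
  · rw [Set.indicator_of_notMem (by exact hp)]
    simp [density, exponentialPDF_of_neg (sub_neg.2 (not_le.1 hp))]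

theorem prod_eq_restrict_le_add_restrict_ge {μ ν : Measure ℝ} [SFinite ν]
    [NullSingletonClass ν] : μ.prod ν = (μ.prod ν).restrict {p | p.1 ≤ p.2} +
      (μ.prod ν).restrict {p | p.2 ≤ p.1} := by
  have hdiag : μ.prod ν {p | p.1 = p.2} = 0 := by
    rw [Measure.measure_prod_null (measurableSet_eq_fun measurable_fst measurable_snd)]
    refine Filter.Eventually.of_forall fun x => ?_
    simp [Set.preimage, measure_singleton]
  have hcompl : ({p : ℝ × ℝ | p.2 ≤ p.1} : Set (ℝ × ℝ)) =ᵐ[μ.prod ν]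
      ({p | p.1 ≤ p.2}ᶜ : Set (ℝ × ℝ)) := by
    filter_upwards [compl_mem_ae_iff.2 hdiag] with p hp
    have hne : p.2 ≠ p.1 := Ne.symm hp
    exact propext (hne.le_iff_lt.trans not_le.symm)
  rw [Measure.restrict_congr_set hcompl,
    Measure.restrict_add_restrict_compl (measurableSet_le measurable_fst measurable_snd)]

theorem prod_expMeasure_restrict_ge {a b : ℝ} (ha : 0 < a) (hb : 0 < b) :
    ((expMeasure a).prod (expMeasure b)).restrict {p | p.2 ≤ p.1} =
      ENNReal.ofReal (b / (a + b)) •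
        ((expMeasure a).prod (expMeasure (a + b))).map fun p => (p.1 + p.2, p.2) := by
  have hle : MeasurableSet {p : ℝ × ℝ | p.2 ≤ p.1} := measurableSet_le measurable_snd measurable_fst
  rw [← Measure.prod_swap, Measure.restrict_map measurable_swap hle]
  change ((((expMeasure b).prod (expMeasure a)).restrict {p | p.1 ≤ p.2}).map Prod.swap) = _
  rw [prod_expMeasure_restrict_le hb ha, Measure.map_smul, ← Measure.prod_swap (μ := expMeasure a),
    Measure.map_map (by fun_prop) (by fun_prop), Measure.map_map (by fun_prop) (by fun_prop),
    add_comm b a]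
  congr 2
  ext p <;> simp [add_comm]

theorem prod_expMeasure_eq_add {a b : ℝ} (ha : 0 < a) (hb : 0 < b) :
    (expMeasure a).prod (expMeasure b) =
      ENNReal.ofReal (a / (a + b)) •
        ((expMeasure (a + b)).prod (expMeasure b)).map (fun p => (p.1, p.1 + p.2)) +
      ENNReal.ofReal (b / (a + b)) •
        ((expMeasure a).prod (expMeasure (a + b))).map (fun p => (p.1 + p.2, p.2)) := by
  rw [← prod_expMeasure_restrict_le ha hb, ← prod_expMeasure_restrict_ge ha hb,
    ← prod_eq_restrict_le_add_restrict_ge]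

end Exponential

/-- `y` with `y w` added to the other coordinates in `F`. -/
def addToOthers {δ : Type*} [DecidableEq δ] (F : Finset δ) (w : δ) (y : δ → ℝ) : δ → ℝ :=
  fun u => if u ∈ F ∧ u ≠ w then y u + y w else y u

@[fun_prop]
theorem measurable_addToOthers {δ : Type*} [DecidableEq δ] (F : Finset δ) (w : δ) :
    Measurable (addToOthers F w) := by
  refine measurable_pi_iff.2 fun u => ?_
  unfold addToOthers
  split_ifs <;> fun_prop

section AddToOthers

variable {δ : Type*} [DecidableEq δ] {F : Finset δ} {i w : δ}

theorem addToOthers_singleton (w : δ) : addToOthers {w} w = id := by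
  ext y u
  simp only [addToOthers, Finset.mem_singleton, id_eq, and_not_self, ne_eq, if_false]

theorem addToOthers_update_add (hw : w ∉ F) (hi : i ∈ F) (y : δ → ℝ) :
    addToOthers F i (Function.update y w (y i + y w)) = addToOthers (Finset.cons w F hw) i y := by
  have hiw : i ≠ w := fun h => hw (h ▸ hi)
  ext u
  simp only [addToOthers, Finset.mem_cons]
  by_cases hu : u = w
  · subst hu
    simp [hw, hiw.symm, add_comm]
  · simp [hu, hiw]

theorem addToOthers_addToOthers (hw : w ∉ F) (hi : i ∈ F) (y : δ → ℝ) :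
    addToOthers F i (Function.update y i (y i + y w)) =
      addToOthers (Finset.cons w F hw) w (addToOthers F i y) := by
  have hiw : i ≠ w := fun h => hw (h ▸ hi)
  ext u
  simp only [addToOthers, Finset.mem_cons]
  by_cases hu : u = w
  · subst hu
    simp [hw, hiw.symm]
  · by_cases hui : u = i
    · subst hui
      simp [hu, hi, hw]
    · by_cases huF : u ∈ F
      · simp [hu, hui, huF, hw, add_assoc]
      · simp [hu, hui, huF]

theorem sum_mul_addToOthers [Fintype δ] (hw : w ∈ F) (a y : δ → ℝ) :
    ∑ v, a v * addToOthers F w y v = ∑ v, a v * y v + (∑ v ∈ F, a v - a w) * y w := by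
  have hterm : ∀ v, a v * addToOthers F w y v =
      a v * y v + if v ∈ F.erase w then a v * y w else 0 := by
    intro v
    simp only [addToOthers, Finset.mem_erase, and_comm (a := v ≠ w)]
    split_ifs <;> ring
  rw [Finset.sum_congr rfl fun v _ => hterm v, Finset.sum_add_distrib, Finset.sum_ite_mem,
    Finset.univ_inter, ← Finset.sum_mul, ← Finset.sum_erase_eq_sub hw]

end AddToOthers

section ExpPi

variable {δ : Type*} [Fintype δ]

/-- The joint law of independent exponential variables with rates `r`. -/
noncomputable def expPi (r : δ → ℝ) : Measure (δ → ℝ) := Measure.pi fun v => expMeasure (r v)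

instance sigmaFinite_expPi (r : δ → ℝ) : SigmaFinite (expPi r) := by
  unfold expPi
  infer_instance

theorem isProbabilityMeasure_expPi {r : δ → ℝ} (hr : ∀ v, 0 < r v) :
    IsProbabilityMeasure (expPi r) := by
  have := fun v => isProbabilityMeasure_expMeasure (hr v)
  unfold expPi
  infer_instance

theorem ae_nonneg_expPi (r : δ → ℝ) : ∀ᵐ y ∂expPi r, ∀ v, 0 ≤ y v :=
  ae_all_iff.2 fun v => (Measure.quasiMeasurePreserving_eval (fun v => expMeasure (r v)) v).ae
    (ae_nonneg_expMeasure (r v))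

theorem lintegral_ofReal_eval_expPi {r : δ → ℝ} (hr : ∀ v, 0 < r v) (v : δ) :
    ∫⁻ y, ENNReal.ofReal (y v) ∂expPi r = ENNReal.ofReal (1 / r v) := by
  have := fun v => isProbabilityMeasure_expMeasure (hr v)
  rw [← lintegral_ofReal_expMeasure (hr v)]
  exact (measurePreserving_eval (fun v => expMeasure (r v)) v).lintegral_comp
    (f := fun x => ENNReal.ofReal x) (by fun_prop)

theorem map_expPi_comp_equiv {δ' : Type*} [Fintype δ'] (r : δ → ℝ) (π : δ' ≃ δ) :
    (expPi r).map (fun y v => y (π v)) = expPi fun v => r (π v) := by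
  have h := (measurePreserving_piCongrLeft (fun v => expMeasure (r v)) π).symm.map_eq
  exact h

variable [DecidableEq δ]

theorem map_update_prod_expPi {r : δ → ℝ} {v : δ} (hv : 0 < r v) (x : ℝ) :
    ((expPi r).prod (expMeasure x)).map (fun p => Function.update p.1 v p.2) =
      expPi (Function.update r v x) := by
  have := isProbabilityMeasure_expMeasure hv
  refine (Measure.pi_eq fun s hs => ?_).symm
  have hpre : (fun p : (δ → ℝ) × ℝ => Function.update p.1 v p.2) ⁻¹' Set.univ.pi s =
      Set.univ.pi (Function.update s v Set.univ) ×ˢ s v := by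
    ext p
    simp only [Set.mem_preimage, Set.mem_univ_pi, Set.mem_prod]
    rw [Function.forall_update_iff p.1 fun u z => z ∈ s u,
      Function.forall_update_iff s fun u t => p.1 u ∈ t]
    simp [and_comm]
  rw [Measure.map_apply (by fun_prop) (.univ_pi hs), hpre, Measure.prod_prod, expPi,
    Measure.pi_pi, ← Finset.mul_prod_erase _ _ (Finset.mem_univ v),
    ← Finset.mul_prod_erase Finset.univ (fun u => expMeasure (Function.update r v x u) (s u))
      (Finset.mem_univ v)]
  simp only [Function.update_self, measure_univ, one_mul]
  rw [mul_comm]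
  congr 1
  refine Finset.prod_congr rfl fun u hu => ?_
  rw [Function.update_of_ne (Finset.ne_of_mem_erase hu),
    Function.update_of_ne (Finset.ne_of_mem_erase hu)]

theorem map_update_update_prod_expPi {r : δ → ℝ} {v w : δ} (hvw : v ≠ w) (hv : 0 < r v)
    (hw : 0 < r w) (a b : ℝ) :
    ((expPi r).prod ((expMeasure a).prod (expMeasure b))).map
        (fun p => Function.update (Function.update p.1 v p.2.1) w p.2.2) =
      expPi (Function.update (Function.update r v a) w b) := by
  have hw' : 0 < Function.update r v a w := by rwa [Function.update_of_ne hvw.symm]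
  have hmap := Measure.map_prod_map ((expPi r).prod (expMeasure a)) (expMeasure b)
    (f := fun p => Function.update p.1 v p.2) (by fun_prop) measurable_id
  rw [Measure.map_id] at hmap
  rw [← map_update_prod_expPi hw', ← map_update_prod_expPi hv, hmap, ← Measure.prodAssoc_prod,
    Measure.map_map (by fun_prop) (by fun_prop), Measure.map_map (by fun_prop) (by fun_prop)]
  rfl

theorem expPi_eq_add_map {r : δ → ℝ} {v w : δ} (hvw : v ≠ w) (hv : 0 < r v) (hw : 0 < r w) :
    expPi r = ENNReal.ofReal (r v / (r v + r w)) • (expPi (Function.update r v (r v + r w))).map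
          (fun y => Function.update y w (y v + y w)) +
      ENNReal.ofReal (r w / (r v + r w)) • (expPi (Function.update r w (r v + r w))).map
          (fun y => Function.update y v (y v + y w)) := by
  have hleft : Function.update (Function.update r v (r v + r w)) w (r w) =
      Function.update r v (r v + r w) := by
    rw [Function.update_comm hvw, Function.update_eq_self]
  have hright : Function.update (Function.update r v (r v)) w (r v + r w) =
      Function.update r w (r v + r w) := by
    rw [Function.update_eq_self]
  have hshift {f : ℝ × ℝ → ℝ × ℝ} (hf : Measurable f) (a b : ℝ) :
      (((expPi r).prod (((expMeasure a).prod (expMeasure b)).map f)).map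
        fun p => Function.update (Function.update p.1 v p.2.1) w p.2.2) =
      ((expPi r).prod ((expMeasure a).prod (expMeasure b))).map fun p =>
        Function.update (Function.update p.1 v (f p.2).1) w (f p.2).2 := by
    have hmap := Measure.map_prod_map (expPi r) ((expMeasure a).prod (expMeasure b))
      measurable_id hf
    rw [Measure.map_id] at hmap
    rw [hmap, Measure.map_map (by fun_prop) (by fun_prop)]
    rfl
  have hr := map_update_update_prod_expPi hvw hv hw (r v) (r w)
  rw [Function.update_eq_self, Function.update_eq_self] at hr
  nth_rewrite 1 [← hr]
  rw [← hleft, ← hright, ← map_update_update_prod_expPi hvw hv hw,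
    ← map_update_update_prod_expPi hvw hv hw, prod_expMeasure_eq_add hv hw, Measure.prod_add,
    Measure.map_add _ _ (by fun_prop), Measure.prod_smul_right, Measure.prod_smul_right,
    Measure.map_smul, Measure.map_smul, hshift (by fun_prop), hshift (by fun_prop),
    Measure.map_map (by fun_prop) (by fun_prop), Measure.map_map (by fun_prop) (by fun_prop)]
  congr 4 <;> ext p u
  · simp [Function.update_of_ne hvw]
  · simp [Function.update_comm hvw, hvw.symm]

theorem map_update_mul_expPi {r : δ → ℝ} {v : δ} (hv : 0 < r v) {a : ℝ} (ha : 0 < a) :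
    (expPi r).map (fun y => Function.update y v (a * y v)) =
      expPi (Function.update r v (r v / a)) := by
  have hmap := Measure.map_prod_map (expPi r) (expMeasure (r v)) measurable_id
    (measurable_const_mul a)
  rw [Measure.map_id, map_mul_left_expMeasure hv ha] at hmap
  have hr := map_update_prod_expPi hv (r v)
  rw [Function.update_eq_self] at hr
  rw [← map_update_prod_expPi hv, hmap, Measure.map_map (by fun_prop) (by fun_prop)]
  nth_rewrite 1 [← hr]
  rw [Measure.map_map (by fun_prop) (by fun_prop)]
  congr! 2
  ext p
  simp

theorem map_addToOthers_expPi {F : Finset δ} {r : δ → ℝ} {v w : δ} (hv : v ∈ F) (hw : w ∉ F)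
    (hrv : 0 < r v) (hrw : 0 < r w) :
    (expPi r).map (addToOthers F v) =
      ENNReal.ofReal (r w / (r v + r w)) • ((expPi (Function.update r w (r v + r w))).map
        (addToOthers F v)).map (addToOthers (Finset.cons w F hw) w) +
      ENNReal.ofReal (r v / (r v + r w)) • (expPi (Function.update r v (r v + r w))).map
        (addToOthers (Finset.cons w F hw) v) := by
  have hvw : v ≠ w := fun h => hw (h ▸ hv)
  rw [expPi_eq_add_map hvw hrv hrw, add_comm, Measure.map_add _ _ (by fun_prop),
    Measure.map_smul, Measure.map_smul]
  iterate 3 rw [Measure.map_map (by fun_prop) (by fun_prop)]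
  congr 3
  · exact funext fun y => addToOthers_addToOthers hw hv y
  · exact funext fun y => addToOthers_update_add hw hv y

theorem expPi_eq_sum_map_addToOthers {F : Finset δ} (hF : F.Nonempty) {r : δ → ℝ}
    (hr : ∀ v, 0 < r v) :
    expPi r = ∑ w ∈ F, ENNReal.ofReal (r w / ∑ v ∈ F, r v) •
      (expPi (Function.update r w (∑ v ∈ F, r v))).map (addToOthers F w) := by
  induction hF using Finset.Nonempty.cons_induction generalizing r with
  | singleton a => simp [(hr a).ne', addToOthers_singleton]
  | cons w F hw hF ih =>
    have hL : 0 < ∑ v ∈ F, r v := Finset.sum_pos (fun v _ => hr v) hF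
    rw [Finset.sum_cons, Finset.sum_cons, add_comm (r w)]
    set L := ∑ v ∈ F, r v
    have hLw : 0 < L + r w := add_pos hL (hr w)
    have hne : ∀ i ∈ F, i ≠ w := fun i hi h => hw (h ▸ hi)
    have hterm : ∀ i ∈ F, ENNReal.ofReal (r i / L) •
        (expPi (Function.update r i L)).map (addToOthers F i) =
        ENNReal.ofReal (r w / (L + r w)) • (ENNReal.ofReal (r i / L) •
          (expPi (Function.update (Function.update r w (L + r w)) i L)).map
            (addToOthers F i)).map (addToOthers (Finset.cons w F hw) w) +
        ENNReal.ofReal (r i / (L + r w)) • (expPi (Function.update r i (L + r w))).map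
          (addToOthers (Finset.cons w F hw) i) := by
      intro i hi
      have hiw := hne i hi
      rw [map_addToOthers_expPi hi hw (by simpa using hL) (by simpa [hiw.symm] using hr w)]
      simp only [Function.update_self, Function.update_of_ne hiw.symm, Function.update_idem,
        Measure.map_smul]
      rw [smul_add, smul_smul, smul_smul, smul_smul, mul_comm (ENNReal.ofReal (r i / L)),
        ← ENNReal.ofReal_mul (div_pos (hr i) hL).le, div_mul_div_cancel₀ hL.ne',
        Function.update_comm hiw]
    have hr' : ∀ v, 0 < Function.update r w (L + r w) v := fun v => by
      by_cases h : v = w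
      · simpa [h] using hLw
      · simpa [h] using hr v
    have hL' : ∑ v ∈ F, Function.update r w (L + r w) v = L :=
      Finset.sum_congr rfl fun v hv => Function.update_of_ne (hne v hv) _ _
    have ih' := congrArg (Measure.map (addToOthers (Finset.cons w F hw) w)) (ih hr')
    rw [hL', Measure.map_finset_sum (by fun_prop)] at ih'
    conv_lhs => rw [ih hr]
    rw [Finset.sum_congr rfl hterm, Finset.sum_add_distrib, ← Finset.smul_sum, ih']
    refine congrArg (_ • · + _) (Finset.sum_congr rfl fun i hi => ?_)
    rw [Function.update_of_ne (hne i hi)]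

end ExpPi

section Assignment

variable {k m n : ℕ}

theorem exists_isAssignment (hm : k ≤ m) (hn : k ≤ n) :
    ∃ s : Finset (Fin m × Fin n), IsAssignment k s := by
  refine ⟨Finset.univ.image fun a : Fin k => (Fin.castLE hm a, Fin.castLE hn a), ?_, ?_⟩
  · rw [Finset.card_image_of_injective _ fun a b h => by simpa using h, Finset.card_fin]
  · simp only [Finset.mem_image, Finset.mem_univ, true_and]
    rintro _ ⟨a, rfl⟩ _ ⟨b, rfl⟩ h
    have hab : a ≠ b := fun e => h (by rw [e])
    simpa using hab

theorem IsAssignment.injOn_fst {s : Finset (Fin m × Fin n)} (hs : IsAssignment k s) :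
    Set.InjOn Prod.fst (s : Set (Fin m × Fin n)) :=
  fun a ha b hb hab => by_contra fun h => (hs.2 a ha b hb h).1 hab

theorem IsAssignment.injOn_snd {s : Finset (Fin m × Fin n)} (hs : IsAssignment k s) :
    Set.InjOn Prod.snd (s : Set (Fin m × Fin n)) :=
  fun a ha b hb hab => by_contra fun h => (hs.2 a ha b hb h).2 hab

theorem IsAssignment.map_snd {s : Finset (Fin m × Fin n)} (hs : IsAssignment k s)
    (π : Equiv.Perm (Fin n)) :
    IsAssignment k (s.map (Equiv.prodCongr (Equiv.refl _) π).toEmbedding) := by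
  refine ⟨by rw [Finset.card_map, hs.1], ?_⟩
  simp only [Finset.mem_map]
  rintro _ ⟨a, ha, rfl⟩ _ ⟨b, hb, rfl⟩ hab
  simpa using hs.2 a ha b hb (fun e => hab (by rw [e]))

theorem IsAssignment.insert_erase {s : Finset (Fin m × Fin n)} (hs : IsAssignment k s)
    {d e : Fin m × Fin n} (hd : d ∈ s) (he : e ∉ s)
    (hfree : ∀ e' ∈ s, e' ≠ d → e'.1 ≠ e.1 ∧ e'.2 ≠ e.2) :
    IsAssignment k (insert e (s.erase d)) := by
  refine ⟨?_, fun a ha b hb hab => ?_⟩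
  · rw [Finset.card_insert_of_notMem (fun h => he (Finset.mem_of_mem_erase h)),
      Finset.card_erase_add_one hd, hs.1]
  · rw [Finset.mem_insert, Finset.mem_erase] at ha hb
    rcases ha with rfl | ⟨had, ha⟩ <;> rcases hb with rfl | ⟨hbd, hb⟩
    · exact absurd rfl hab
    · exact ⟨(hfree b hb hbd).1.symm, (hfree b hb hbd).2.symm⟩
    · exact hfree a ha had
    · exact hs.2 a ha b hb hab

theorem minAssignmentSum_le (A : Fin m → Fin n → ℝ) {s : Finset (Fin m × Fin n)}
    (hs : IsAssignment k s) : minAssignmentSum k A ≤ ∑ e ∈ s, A e.1 e.2 :=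
  ciInf_le (f := fun s : {s : Finset (Fin m × Fin n) // IsAssignment k s} => ∑ e ∈ s.1, A e.1 e.2)
    (Set.finite_range _).bddBelow ⟨s, hs⟩

theorem exists_minAssignmentSum_eq (hm : k ≤ m) (hn : k ≤ n) (A : Fin m → Fin n → ℝ) :
    ∃ s, IsAssignment k s ∧ minAssignmentSum k A = ∑ e ∈ s, A e.1 e.2 := by
  obtain ⟨s₀, hs₀⟩ := exists_isAssignment hm hn
  have : Nonempty {s : Finset (Fin m × Fin n) // IsAssignment k s} := ⟨⟨s₀, hs₀⟩⟩
  obtain ⟨s, hs⟩ := exists_eq_ciInf_of_finite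
    (f := fun s : {s : Finset (Fin m × Fin n) // IsAssignment k s} => ∑ e ∈ s.1, A e.1 e.2)
  exact ⟨s.1, s.2, hs.symm⟩

theorem minAssignmentSum_nonneg {A : Fin m → Fin n → ℝ} (hA : ∀ i j, 0 ≤ A i j) :
    0 ≤ minAssignmentSum k A :=
  Real.iInf_nonneg fun _ => Finset.sum_nonneg fun _ _ => hA _ _

theorem minAssignmentSum_comp_perm (hm : k ≤ m) (hn : k ≤ n) (A : Fin m → Fin n → ℝ)
    (π : Equiv.Perm (Fin n)) :
    minAssignmentSum k (fun i j => A i (π j)) = minAssignmentSum k A := by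
  have hle : ∀ (B : Fin m → Fin n → ℝ) (ρ : Equiv.Perm (Fin n)),
      minAssignmentSum k B ≤ minAssignmentSum k (fun i j => B i (ρ j)) := by
    intro B ρ
    obtain ⟨s, hs, heq⟩ := exists_minAssignmentSum_eq hm hn fun i j => B i (ρ j)
    rw [heq]
    refine (minAssignmentSum_le B (hs.map_snd ρ)).trans_eq ?_
    rw [Finset.sum_map]
    rfl
  refine le_antisymm ?_ (hle A π)
  simpa using hle (fun i j => A i (π j)) π.symm

theorem measurable_minAssignmentSum {α : Type*} [MeasurableSpace α]
    {A : α → Fin m → Fin n → ℝ} (hA : ∀ i j, Measurable fun y => A y i j) :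
    Measurable fun y => minAssignmentSum k (A y) :=
  Measurable.iInf fun _ => Finset.measurable_sum _ fun e _ => hA e.1 e.2

theorem minAssignmentSum_eq_zero {A : Fin m → Fin n → ℝ} (hA : ∀ i j, 0 ≤ A i j)
    {s : Finset (Fin m × Fin n)} {r : ℕ} (hs : IsAssignment r s) (hk : k ≤ r)
    (h0 : ∀ e ∈ s, A e.1 e.2 = 0) : minAssignmentSum k A = 0 := by
  obtain ⟨t, hts, ht⟩ := Finset.exists_subset_card_eq (hs.1.symm ▸ hk)
  refine le_antisymm ?_ (minAssignmentSum_nonneg hA)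
  refine (minAssignmentSum_le A (s := t)
    ⟨ht, fun e he e' he' => hs.2 e (hts he) e' (hts he')⟩).trans_eq ?_
  exact Finset.sum_eq_zero fun e he => h0 e (hts he)

-- Choose an optimal assignment with as many positions in `M` as possible.
theorem exists_optimal_not_exchangeable (hm : k ≤ m) (hn : k ≤ n) {B : Fin m → Fin n → ℝ}
    (hB : ∀ i j, 0 ≤ B i j) {M : Finset (Fin m × Fin n)} (h0 : ∀ e ∈ M, B e.1 e.2 = 0) :
    ∃ s, IsAssignment k s ∧ minAssignmentSum k B = ∑ e ∈ s, B e.1 e.2 ∧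
      ∀ e ∈ M, e ∉ s → ∀ d ∈ s, d ∉ M → ∃ e' ∈ s, e' ≠ d ∧ (e'.1 = e.1 ∨ e'.2 = e.2) := by
  classical
  let opt : Finset (Finset (Fin m × Fin n)) :=
    {s | IsAssignment k s ∧ minAssignmentSum k B = ∑ e ∈ s, B e.1 e.2}
  have hopt {s} : s ∈ opt ↔ IsAssignment k s ∧ minAssignmentSum k B = ∑ e ∈ s, B e.1 e.2 :=
    Finset.mem_filter_univ s
  have hne : opt.Nonempty := (exists_minAssignmentSum_eq hm hn B).imp fun s hs => hopt.2 hs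
  obtain ⟨s, hs, hmax⟩ := Finset.exists_max_image opt (fun s => (s ∩ M).card) hne
  obtain ⟨hsa, hsm⟩ := hopt.1 hs
  refine ⟨s, hsa, hsm, fun e heM hes d hds hdM => ?_⟩
  by_contra! hfree
  have hass : IsAssignment k (insert e (s.erase d)) := hsa.insert_erase hds hes hfree
  have hsum : ∑ e' ∈ insert e (s.erase d), B e'.1 e'.2 ≤ ∑ e' ∈ s, B e'.1 e'.2 := by
    rw [Finset.sum_insert (fun h => hes (Finset.mem_of_mem_erase h)), h0 e heM, zero_add]
    exact Finset.sum_le_sum_of_subset_of_nonneg (Finset.erase_subset _ _) fun _ _ _ => hB _ _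
  have hmem : insert e (s.erase d) ∈ opt :=
    hopt.2 ⟨hass, le_antisymm (minAssignmentSum_le B hass) (hsum.trans_eq hsm.symm)⟩
  have hinter : insert e (s.erase d) ∩ M = insert e (s ∩ M) := by
    rw [Finset.insert_inter_of_mem heM, Finset.erase_inter,
      Finset.erase_eq_of_notMem fun h => hdM (Finset.mem_inter.1 h).2]
  have hle := hmax _ hmem
  rw [hinter, Finset.card_insert_of_notMem fun h => hes (Finset.mem_inter.1 h).1] at hle
  omega

theorem exists_optimal_saturating (hm : k ≤ m) (hn : k ≤ n) {B : Fin m → Fin n → ℝ}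
    (hB : ∀ i j, 0 ≤ B i j) {M : Finset (Fin m × Fin n)} {r : ℕ} (hM : IsAssignment r M)
    (hr : r ≤ k) (h0 : ∀ e ∈ M, B e.1 e.2 = 0) :
    ∃ s, IsAssignment k s ∧ minAssignmentSum k B = ∑ e ∈ s, B e.1 e.2 ∧
      M.image Prod.fst ⊆ s.image Prod.fst ∧ M.image Prod.snd ⊆ s.image Prod.snd := by
  obtain ⟨s, hs, hmin, hex⟩ := exists_optimal_not_exchangeable hm hn hB h0
  have houtside : ∀ e ∈ M, e ∉ s → ∃ d ∈ s, d ∉ M := by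
    intro e heM hes
    refine Finset.not_subset.1 fun hsM => hes ?_
    rwa [Finset.eq_of_subset_of_card_le hsM (by rw [hs.1, hM.1]; exact hr)]
  refine ⟨s, hs, hmin, Finset.image_subset_iff.2 fun e heM => by_contra fun hrow => ?_,
    Finset.image_subset_iff.2 fun e heM => by_contra fun hcol => ?_⟩
  · have hrow' : ∀ e' ∈ s, e'.1 ≠ e.1 := fun e' he' h => hrow (Finset.mem_image.2 ⟨e', he', h⟩)
    have hes : e ∉ s := fun h => hrow' e h rfl
    by_cases hcol : ∃ d ∈ s, d.2 = e.2
    · obtain ⟨d, hds, hd⟩ := hcol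
      have hdM : d ∉ M := fun hdM => hes (hM.injOn_snd hdM heM hd ▸ hds)
      obtain ⟨e', he', hne, h | h⟩ := hex e heM hes d hds hdM
      · exact hrow' e' he' h
      · exact hne (hs.injOn_snd he' hds (h.trans hd.symm))
    · obtain ⟨d, hds, hdM⟩ := houtside e heM hes
      obtain ⟨e', he', -, h | h⟩ := hex e heM hes d hds hdM
      exacts [hrow' e' he' h, hcol ⟨e', he', h⟩]
  · have hcol' : ∀ e' ∈ s, e'.2 ≠ e.2 := fun e' he' h => hcol (Finset.mem_image.2 ⟨e', he', h⟩)
    have hes : e ∉ s := fun h => hcol' e h rfl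
    by_cases hrow : ∃ d ∈ s, d.1 = e.1
    · obtain ⟨d, hds, hd⟩ := hrow
      have hdM : d ∉ M := fun hdM => hes (hM.injOn_fst hdM heM hd ▸ hds)
      obtain ⟨e', he', hne, h | h⟩ := hex e heM hes d hds hdM
      · exact hne (hs.injOn_fst he' hds (h.trans hd.symm))
      · exact hcol' e' he' h
    · obtain ⟨d, hds, hdM⟩ := houtside e heM hes
      obtain ⟨e', he', -, h | h⟩ := hex e heM hes d hds hdM
      exacts [hrow ⟨e', he', h⟩, hcol' e' he' h]

theorem sum_ite_comp_eq_card_image_inter {α β : Type*} [DecidableEq β] {s : Finset α} {f : α → β}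
    (hf : Set.InjOn f s) (T : Finset β) :
    ∑ a ∈ s, (if f a ∈ T then (1 : ℝ) else 0) = (s.image f ∩ T).card := by
  rw [← Finset.sum_image (f := fun b => if b ∈ T then (1 : ℝ) else 0) hf]
  simp

theorem IsAssignment.sum_dual {s : Finset (Fin m × Fin n)} (hs : IsAssignment k s)
    (B : Fin m → Fin n → ℝ) (t : ℝ) (R : Finset (Fin m)) (C : Finset (Fin n)) :
    ∑ e ∈ s, (B e.1 e.2 + t * (1 - (if e.1 ∈ R then 1 else 0) - (if e.2 ∈ C then 1 else 0))) =
      ∑ e ∈ s, B e.1 e.2 +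
        t * (k - (s.image Prod.fst ∩ R).card - (s.image Prod.snd ∩ C).card) := by
  rw [← sum_ite_comp_eq_card_image_inter hs.injOn_fst,
    ← sum_ite_comp_eq_card_image_inter hs.injOn_snd, Finset.sum_add_distrib, ← Finset.mul_sum,
    Finset.sum_sub_distrib, Finset.sum_sub_distrib, Finset.sum_const, hs.1, nsmul_one]

-- The dual step of the Hungarian algorithm: every assignment changes by at least `t * (k - r)`,
-- with equality for those that meet all rows of `R` and all columns of `C`.
theorem minAssignmentSum_eq_add_mul (hm : k ≤ m) (hn : k ≤ n) {B : Fin m → Fin n → ℝ}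
    (hB : ∀ i j, 0 ≤ B i j) {t : ℝ} (ht : 0 ≤ t) {M : Finset (Fin m × Fin n)} {r : ℕ}
    (hM : IsAssignment r M) (hr : r ≤ k) (h0 : ∀ e ∈ M, B e.1 e.2 = 0)
    {R : Finset (Fin m)} {C : Finset (Fin n)} (hR : R ⊆ M.image Prod.fst)
    (hC : C ⊆ M.image Prod.snd) (hRC : R.card + C.card = r) :
    minAssignmentSum k (fun i j =>
        B i j + t * (1 - (if i ∈ R then 1 else 0) - (if j ∈ C then 1 else 0))) =
      minAssignmentSum k B + t * (k - r : ℝ) := by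
  have hrR : (r : ℝ) = R.card + C.card := by exact_mod_cast hRC.symm
  refine le_antisymm ?_ ?_
  · obtain ⟨s, hs, hmin, hrows, hcols⟩ := exists_optimal_saturating hm hn hB hM hr h0
    refine (minAssignmentSum_le _ hs).trans_eq ?_
    rw [hs.sum_dual, hmin, Finset.inter_eq_right.2 (hR.trans hrows),
      Finset.inter_eq_right.2 (hC.trans hcols), hrR, sub_sub]
  · obtain ⟨s, hs, hmin⟩ := exists_minAssignmentSum_eq hm hn fun i j =>
      B i j + t * (1 - (if i ∈ R then 1 else 0) - (if j ∈ C then 1 else 0))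
    rw [hmin, hs.sum_dual]
    refine add_le_add (minAssignmentSum_le B hs) (mul_le_mul_of_nonneg_left ?_ ht)
    have hrows : ((s.image Prod.fst ∩ R).card : ℝ) ≤ R.card := by
      exact_mod_cast Finset.card_le_card Finset.inter_subset_right
    have hcols : ((s.image Prod.snd ∩ C).card : ℝ) ≤ C.card := by
      exact_mod_cast Finset.card_le_card Finset.inter_subset_right
    linarith

end Assignment

section RationalSequence

open Polynomial

/-- All complex zeros of `p` are real and less than `k`. -/
def RootsRealLT (k : ℕ) (p : ℝ[X]) : Prop :=
  ∀ z : ℂ, aeval z p = 0 → z.im = 0 ∧ z.re < k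

theorem RootsRealLT.mul {k : ℕ} {p q : ℝ[X]} (hp : RootsRealLT k p) (hq : RootsRealLT k q) :
    RootsRealLT k (p * q) := by
  intro z hz
  rw [map_mul, mul_eq_zero] at hz
  exact hz.elim (hp z) (hq z)

theorem RootsRealLT.eval_ne_zero {k : ℕ} {p : ℝ[X]} (hp : RootsRealLT k p) {x : ℝ}
    (hx : (k : ℝ) ≤ x) : p.eval x ≠ 0 := by
  intro h
  have hroot : aeval (x : ℂ) p = 0 := by
    simpa [coe_aeval_eq_eval, h] using aeval_algebraMap_apply ℂ x p
  exact (hp x hroot).2.not_ge hx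

theorem rootsRealLT_one (k : ℕ) : RootsRealLT k 1 := by
  simp [RootsRealLT]

theorem RootsRealLT.of_dvd {k : ℕ} {p q : ℝ[X]} (hq : RootsRealLT k q) (h : p ∣ q) :
    RootsRealLT k p := by
  obtain ⟨d, rfl⟩ := h
  intro z hz
  exact hq z (by simp [hz])

theorem IsKPositive.exists_polynomial {k : ℕ} {f : ℝ → ℝ} (hf : IsKPositive k f) :
    ∃ p : ℝ[X], RootsRealLT k p ∧ ∀ x, f x = p.eval x := by
  obtain ⟨⟨a, b, hab⟩, hpos⟩ := hf
  refine ⟨C a * X + C b, ?_, fun x => by simp [hab]⟩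
  intro z hz
  simp only [map_add, map_mul, aeval_C, aeval_X, Complex.coe_algebraMap] at hz
  have hre := congrArg Complex.re hz
  have him := congrArg Complex.im hz
  simp only [Complex.add_re, Complex.add_im, Complex.re_ofReal_mul, Complex.im_ofReal_mul,
    Complex.ofReal_re, Complex.ofReal_im, Complex.zero_re, Complex.zero_im, add_zero,
    mul_eq_zero] at hre him
  refine ⟨him.resolve_left fun ha => ?_, lt_of_not_ge fun hlt => ?_⟩
  · have hk := hpos k le_rfl
    rw [ha, zero_mul, zero_add] at hre
    rw [hab, ha, hre] at hk
    simp at hk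
  · have hzpos := hpos _ hlt
    rw [hab, hre] at hzpos
    exact hzpos.false

/-- The sequence `e n`, `n ≥ n₀`, is given by a nonnegative rational function with real poles less
than `k`. -/
def IsRationalSeq (k n₀ : ℕ) (e : ℕ → ℝ≥0∞) : Prop :=
  ∃ p q : ℝ[X], RootsRealLT k q ∧ ∀ n, n₀ ≤ n →
    0 ≤ p.eval (n : ℝ) / q.eval (n : ℝ) ∧ e n = ENNReal.ofReal (p.eval (n : ℝ) / q.eval (n : ℝ))

variable {k n₀ : ℕ} {e e' : ℕ → ℝ≥0∞}

theorem IsRationalSeq.congr (h : IsRationalSeq k n₀ e) (he : ∀ n, n₀ ≤ n → e' n = e n) :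
    IsRationalSeq k n₀ e' := by
  obtain ⟨p, q, hq, hpq⟩ := h
  exact ⟨p, q, hq, fun n hn => ⟨(hpq n hn).1, (he n hn).trans (hpq n hn).2⟩⟩

theorem IsRationalSeq.add (hk : k ≤ n₀) (h : IsRationalSeq k n₀ e) (h' : IsRationalSeq k n₀ e') :
    IsRationalSeq k n₀ (fun n => e n + e' n) := by
  obtain ⟨p, q, hq, hpq⟩ := h
  obtain ⟨p', q', hq', hpq'⟩ := h'
  refine ⟨p * q' + p' * q, q * q', hq.mul hq', fun n hn => ?_⟩
  have hkn : (k : ℝ) ≤ n := by exact_mod_cast hk.trans hn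
  have hq0 := hq.eval_ne_zero hkn
  have hq0' := hq'.eval_ne_zero hkn
  have heval : (p * q' + p' * q).eval (n : ℝ) / (q * q').eval (n : ℝ) =
      p.eval (n : ℝ) / q.eval (n : ℝ) + p'.eval (n : ℝ) / q'.eval (n : ℝ) := by
    simp only [eval_add, eval_mul]
    field_simp
  beta_reduce
  rw [heval, ENNReal.ofReal_add (hpq n hn).1 (hpq' n hn).1, (hpq n hn).2, (hpq' n hn).2]
  exact ⟨add_nonneg (hpq n hn).1 (hpq' n hn).1, rfl⟩

theorem IsRationalSeq.mul (h : IsRationalSeq k n₀ e) (h' : IsRationalSeq k n₀ e') :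
    IsRationalSeq k n₀ (fun n => e n * e' n) := by
  obtain ⟨p, q, hq, hpq⟩ := h
  obtain ⟨p', q', hq', hpq'⟩ := h'
  refine ⟨p * p', q * q', hq.mul hq', fun n hn => ?_⟩
  have heval : (p * p').eval (n : ℝ) / (q * q').eval (n : ℝ) =
      p.eval (n : ℝ) / q.eval (n : ℝ) * (p'.eval (n : ℝ) / q'.eval (n : ℝ)) := by
    simp only [eval_mul, div_mul_div_comm]
  beta_reduce
  rw [heval, ENNReal.ofReal_mul (hpq n hn).1, (hpq n hn).2, (hpq' n hn).2]
  exact ⟨mul_nonneg (hpq n hn).1 (hpq' n hn).1, rfl⟩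

theorem isRationalSeq_const {x : ℝ} (hx : 0 ≤ x) :
    IsRationalSeq k n₀ (fun _ => ENNReal.ofReal x) :=
  ⟨C x, 1, rootsRealLT_one k, fun n _ => by simp [hx]⟩

theorem IsRationalSeq.sum {ι : Type*} (hk : k ≤ n₀) (s : Finset ι) {e : ι → ℕ → ℝ≥0∞}
    (h : ∀ i ∈ s, IsRationalSeq k n₀ (e i)) : IsRationalSeq k n₀ (fun n => ∑ i ∈ s, e i n) := by
  classical
  induction s using Finset.induction_on with
  | empty => simpa using isRationalSeq_const (k := k) (n₀ := n₀) le_rfl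
  | insert a s ha ih =>
    simp only [Finset.sum_insert ha]
    exact (h a (Finset.mem_insert_self _ _)).add hk
      (ih fun i hi => h i (Finset.mem_insert_of_mem hi))

theorem IsKPositive.isRationalSeq_div {f g : ℝ → ℝ} (hk : k ≤ n₀) (hf : IsKPositive k f)
    (hg : IsKPositive k g) : IsRationalSeq k n₀ (fun n => ENNReal.ofReal (f n / g n)) := by
  obtain ⟨p, -, hp⟩ := hf.exists_polynomial
  obtain ⟨q, hq, hgq⟩ := hg.exists_polynomial
  refine ⟨p, q, hq, fun n hn => ?_⟩
  have hkn : (k : ℝ) ≤ n := by exact_mod_cast hk.trans hn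
  rw [← hp, ← hgq]
  exact ⟨(div_pos (hf.2 n hkn) (hg.2 n hkn)).le, rfl⟩

theorem IsRationalSeq.sub_mul (h : IsRationalSeq k (n₀ + 1) e) :
    IsRationalSeq k n₀ (fun n => ((n - n₀ : ℕ) : ℝ≥0∞) * e n) := by
  obtain ⟨p, q, hq, hpq⟩ := h
  refine ⟨(X - C (n₀ : ℝ)) * p, q, hq, fun n hn => ?_⟩
  rcases hn.eq_or_lt with rfl | hlt
  · simp
  · obtain ⟨hnonneg, heq⟩ := hpq n hlt
    have hsub : ((n - n₀ : ℕ) : ℝ) = n - n₀ := Nat.cast_sub hn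
    simp only [eval_mul, eval_sub, eval_X, eval_C]
    rw [mul_div_assoc, ← hsub, heq, ENNReal.ofReal_mul (Nat.cast_nonneg _), ENNReal.ofReal_natCast]
    exact ⟨mul_nonneg (Nat.cast_nonneg _) hnonneg, rfl⟩

theorem isKPositive_one : IsKPositive k (fun _ => 1) :=
  ⟨⟨0, 1, fun x => by simp⟩, fun _ _ => one_pos⟩

theorem IsKPositive.add {f g : ℝ → ℝ} (hf : IsKPositive k f) (hg : IsKPositive k g) :
    IsKPositive k (fun x => f x + g x) := by
  obtain ⟨⟨a, b, h⟩, hp⟩ := hf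
  obtain ⟨⟨a', b', h'⟩, hp'⟩ := hg
  exact ⟨⟨a + a', b + b', fun x => by simp only [h, h']; ring⟩,
    fun x hx => add_pos (hp x hx) (hp' x hx)⟩

theorem IsKPositive.sum {ι : Type*} {s : Finset ι} (hs : s.Nonempty) {f : ι → ℝ → ℝ}
    (hf : ∀ i ∈ s, IsKPositive k (f i)) : IsKPositive k fun x => ∑ i ∈ s, f i x := by
  simpa only [Finset.sum_fn] using
    Finset.sum_induction_nonempty f (IsKPositive k) (fun _ _ => .add) hs hf

theorem IsKPositive.div_const {f : ℝ → ℝ} (hf : IsKPositive k f) {a : ℝ} (ha : 0 < a) :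
    IsKPositive k (fun x => f x / a) := by
  obtain ⟨⟨b, c, h⟩, hp⟩ := hf
  exact ⟨⟨b / a, c / a, fun x => by simp only [h]; ring⟩, fun x hx => div_pos (hp x hx) ha⟩

theorem isKPositive_mul_sub {a b : ℕ} (ha : 0 < a) (hb : b < k) :
    IsKPositive k (fun x => (a : ℝ) * (x - b)) := by
  refine ⟨⟨a, -(a * b), fun x => by ring⟩, fun x hx => ?_⟩
  have hbk : (b : ℝ) < k := by exact_mod_cast hb
  exact mul_pos (by exact_mod_cast ha) (by linarith)

theorem IsRationalSeq.exists_ratFunc (hk : k ≤ n₀) (h : IsRationalSeq k n₀ e) :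
    ∃ f : RatFunc ℝ, RootsRealLT k f.denom ∧
      ∀ n, n₀ ≤ n → e n = ENNReal.ofReal (f.eval (RingHom.id ℝ) n) ∧
        0 ≤ f.eval (RingHom.id ℝ) n := by
  obtain ⟨p, q, hq, hpq⟩ := h
  have hq0 : q ≠ 0 := fun hq0 =>
    hq.eval_ne_zero (le_refl (k : ℝ)) (by rw [hq0, eval_zero])
  have hdenom : RootsRealLT k
      (algebraMap ℝ[X] (RatFunc ℝ) p / algebraMap ℝ[X] (RatFunc ℝ) q).denom :=
    hq.of_dvd (RatFunc.denom_div_dvd p q)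
  refine ⟨_, hdenom, fun n hn => ?_⟩
  have hkn : (k : ℝ) ≤ n := by exact_mod_cast hk.trans hn
  have heval : RatFunc.eval (RingHom.id ℝ) (n : ℝ)
      (algebraMap ℝ[X] (RatFunc ℝ) p / algebraMap ℝ[X] (RatFunc ℝ) q) =
      p.eval (n : ℝ) / q.eval (n : ℝ) := by
    rw [RatFunc.eval, eval₂_id, eval₂_id,
      div_eq_div_iff (hdenom.eval_ne_zero hkn) (hq.eval_ne_zero hkn), ← eval_mul, ← eval_mul,
      (RatFunc.num_mul_eq_mul_denom_iff hq0).2 rfl]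
  rw [heval]
  exact (hpq n hn).symm

end RationalSequence

section ExpFamily

/-- Indices of the random variables in matrices with `m` rows: `q` special variables, and one for
each position of an `m × ∞` matrix. -/
abbrev Var (q m : ℕ) := Fin q ⊕ (Fin m × ℕ)

/-- The indices of the random variables that exist in a matrix with `n` columns. -/
abbrev FinVar (q m n : ℕ) := Fin q ⊕ (Fin m × Fin n)

/-- The inclusion of the variables of a matrix with `n` columns. -/
def FinVar.emb {q m n : ℕ} : FinVar q m n → Var q m := Sum.map id (Prod.map id Fin.val)

theorem FinVar.emb_injective {q m n : ℕ} :
    Function.Injective (FinVar.emb (q := q) (m := m) (n := n)) :=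
  Function.injective_id.sumMap (Function.injective_id.prodMap Fin.val_injective)

/-- A permutation of the columns acts on the variables. -/
def FinVar.permCols {q m n : ℕ} (π : Equiv.Perm (Fin n)) : Equiv.Perm (FinVar q m n) :=
  Equiv.sumCongr (.refl _) (Equiv.prodCongr (.refl _) π)

/-- The variable exists in a matrix with `n` columns. -/
def Var.Below {q m : ℕ} (n : ℕ) (v : Var q m) : Prop := ∀ i j, v = Sum.inr (i, j) → j < n

theorem Var.Below.mono {q m n n' : ℕ} {v : Var q m} (h : v.Below n) (hn : n ≤ n') : v.Below n' :=
  fun i j e => (h i j e).trans_le hn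

theorem Var.Below.exists_emb {q m n : ℕ} {v : Var q m} (h : v.Below n) :
    ∃ u : FinVar q m n, u.emb = v := by
  rcases v with l | ⟨i, j⟩
  · exact ⟨Sum.inl l, rfl⟩
  · exact ⟨Sum.inr (i, ⟨j, h i j rfl⟩), rfl⟩

/-- A family, over all numbers `n` of columns, of matrices with `m` rows whose entries are linear
forms in independent exponential variables. Only the rates of the variables depend on `n`. -/
structure ExpFamily (q m : ℕ) where
  /-- The coefficient of a variable in the entry at a position. -/
  coeff : Fin m → ℕ → Var q m → ℝ
  /-- The rate of a variable as a function of the number of columns. -/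
  rate : Var q m → ℝ → ℝ

variable {q m k n : ℕ}

namespace ExpFamily

/-- The `m × n` matrix of the family when the variables have the values `y`. -/
noncomputable def matrix (F : ExpFamily q m) (n : ℕ) (y : FinVar q m n → ℝ) (i : Fin m)
    (j : Fin n) : ℝ :=
  ∑ v, F.coeff i j v.emb * y v

/-- The mean of the minimal assignment sum in the `m × n` matrix of the family. -/
noncomputable def meanCost (F : ExpFamily q m) (k n : ℕ) : ℝ≥0∞ :=
  ∫⁻ y, ENNReal.ofReal (minAssignmentSum k (F.matrix n y)) ∂expPi fun v => F.rate v.emb n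

/-- Replace the coefficients of `w` by `φ` and its rate by `g`. -/
def replace (F : ExpFamily q m) (w : Var q m) (φ : Fin m → ℕ → ℝ) (g : ℝ → ℝ) :
    ExpFamily q m where
  coeff i j := Function.update (F.coeff i j) w (φ i j)
  rate := Function.update F.rate w g

/-- Measure the variable `v` in the unit `a⁻¹`, which does not change the joint law of the
entries. -/
noncomputable def scale (F : ExpFamily q m) (v : Var q m) (a : ℝ) : ExpFamily q m :=
  F.replace v (fun i j => F.coeff i j v / a) fun x => F.rate v x / a

variable {F F' : ExpFamily q m}

theorem coeff_replace (F : ExpFamily q m) (w : Var q m) (φ : Fin m → ℕ → ℝ) (g : ℝ → ℝ) (i : Fin m)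
    (j : ℕ) : (F.replace w φ g).coeff i j = Function.update (F.coeff i j) w (φ i j) := rfl

@[simp]
theorem coeff_replace_self (F : ExpFamily q m) (w : Var q m) (φ : Fin m → ℕ → ℝ) (g : ℝ → ℝ)
    (i : Fin m) (j : ℕ) : (F.replace w φ g).coeff i j w = φ i j :=
  Function.update_self ..

@[simp]
theorem rate_replace_self (F : ExpFamily q m) (w : Var q m) (φ : Fin m → ℕ → ℝ) (g : ℝ → ℝ) :
    (F.replace w φ g).rate w = g :=
  Function.update_self ..

theorem coeff_replace_of_ne (F : ExpFamily q m) {v w : Var q m} (h : v ≠ w) (φ : Fin m → ℕ → ℝ)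
    (g : ℝ → ℝ) (i : Fin m) (j : ℕ) : (F.replace w φ g).coeff i j v = F.coeff i j v :=
  Function.update_of_ne h ..

theorem rate_replace_of_ne (F : ExpFamily q m) {v w : Var q m} (h : v ≠ w) (φ : Fin m → ℕ → ℝ)
    (g : ℝ → ℝ) : (F.replace w φ g).rate v = F.rate v :=
  Function.update_of_ne h ..

theorem coeff_replace_eq_zero {w : Var q m} {φ : Fin m → ℕ → ℝ} {g : ℝ → ℝ} {i : Fin m} {j : ℕ}
    (h : F.coeff i j = 0) (hφ : φ i j = 0) : (F.replace w φ g).coeff i j = 0 := by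
  rw [coeff_replace, h, hφ]
  exact Function.update_eq_self w (0 : Var q m → ℝ)

theorem measurable_cost (F : ExpFamily q m) (k n : ℕ) : Measurable fun y : FinVar q m n → ℝ =>
    ENNReal.ofReal (minAssignmentSum k (F.matrix n y)) := by
  refine (measurable_minAssignmentSum fun i j => ?_).ennreal_ofReal
  unfold matrix
  fun_prop

theorem matrix_replace (w : FinVar q m n) (φ : Fin m → ℕ → ℝ) (g : ℝ → ℝ) (y : FinVar q m n → ℝ)
    (i : Fin m) (j : Fin n) : (F.replace w.emb φ g).matrix n y i j =
      F.matrix n y i j + (φ i j - F.coeff i j w.emb) * y w := by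
  have hrest : ∀ v ∈ Finset.univ.erase w,
      (F.replace w.emb φ g).coeff i j v.emb * y v = F.coeff i j v.emb * y v := fun v hv => by
    rw [coeff_replace_of_ne F (FinVar.emb_injective.ne (Finset.ne_of_mem_erase hv))]
  rw [matrix, matrix, ← Finset.add_sum_erase _ _ (Finset.mem_univ w),
    ← Finset.add_sum_erase _ _ (Finset.mem_univ w), coeff_replace_self,
    Finset.sum_congr rfl hrest]
  ring

theorem rate_replace_emb (w : FinVar q m n) (φ : Fin m → ℕ → ℝ) (g : ℝ → ℝ) :
    (fun v : FinVar q m n => (F.replace w.emb φ g).rate v.emb n) =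
      Function.update (fun v => F.rate v.emb n) w (g n) := by
  ext v
  by_cases h : v = w
  · subst h; rw [rate_replace_self, Function.update_self]
  · rw [rate_replace_of_ne F (FinVar.emb_injective.ne h), Function.update_of_ne h]

theorem matrix_nonneg (hF : ∀ i j v, 0 ≤ F.coeff i j v) {y : FinVar q m n → ℝ}
    (hy : ∀ v, 0 ≤ y v) (i : Fin m) (j : Fin n) : 0 ≤ F.matrix n y i j :=
  Finset.sum_nonneg fun _ _ => mul_nonneg (hF _ _ _) (hy _)

theorem meanCost_scale {v : Var q m} (hv : v.Below n) (hrate : 0 < F.rate v n) {a : ℝ}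
    (ha : 0 < a) : (F.scale v a).meanCost k n = F.meanCost k n := by
  obtain ⟨u, rfl⟩ := hv.exists_emb
  rw [meanCost, scale, rate_replace_emb,
    ← map_update_mul_expPi (r := fun v : FinVar q m n => F.rate v.emb n) (v := u) hrate ha,
    lintegral_map (measurable_cost ..) (by fun_prop)]
  refine lintegral_congr fun y => ?_
  congr 2
  ext i j
  have hrest : ∀ v ∈ Finset.univ.erase u,
      F.coeff i j v.emb * Function.update y u (a * y u) v = F.coeff i j v.emb * y v :=
    fun v hv => by rw [Function.update_of_ne (Finset.ne_of_mem_erase hv)]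
  rw [matrix_replace]
  simp only [matrix]
  rw [← Finset.add_sum_erase _ _ (Finset.mem_univ u),
    ← Finset.add_sum_erase _ _ (Finset.mem_univ u), Function.update_self,
    Finset.sum_congr rfl hrest]
  field_simp
  ring

/-- Condition on the event that `w` is the smallest of the variables in `V`, then express the
others as the sum of `w` and an independent copy of themselves. -/
noncomputable def conditionMin (F : ExpFamily q m) (V : Finset (Var q m)) (w : Var q m) :
    ExpFamily q m :=
  F.replace w (fun i j => ∑ u ∈ V, F.coeff i j u) fun x => ∑ u ∈ V, F.rate u x

theorem lintegral_matrix_addToOthers {V : Finset (FinVar q m n)} {w : FinVar q m n} (hw : w ∈ V) :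
    ∫⁻ y, ENNReal.ofReal (minAssignmentSum k (F.matrix n y)) ∂(expPi (Function.update
      (fun v => F.rate v.emb n) w (∑ v ∈ V, F.rate v.emb n))).map (addToOthers V w) =
    (F.conditionMin (V.image FinVar.emb) w.emb).meanCost k n := by
  rw [lintegral_map (measurable_cost ..) (by fun_prop), meanCost, conditionMin, rate_replace_emb,
    Finset.sum_image FinVar.emb_injective.injOn]
  refine lintegral_congr fun y => ?_
  congr 2
  ext i j
  rw [matrix_replace, Finset.sum_image FinVar.emb_injective.injOn]
  exact sum_mul_addToOthers hw (fun v => F.coeff i j v.emb) y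

theorem meanCost_eq_sum_conditionMin {V : Finset (Var q m)} (hV : V.Nonempty)
    (hVn : ∀ v ∈ V, v.Below n) (hrate : ∀ v, 0 < F.rate v n) :
    F.meanCost k n = ∑ w ∈ V, ENNReal.ofReal (F.rate w n / ∑ u ∈ V, F.rate u n) *
      (F.conditionMin V w).meanCost k n := by
  classical
  obtain ⟨G, rfl⟩ : ∃ G : Finset (FinVar q m n), G.image FinVar.emb = V := by
    refine ⟨V.preimage FinVar.emb FinVar.emb_injective.injOn, ?_⟩
    rw [Finset.image_preimage]
    exact Finset.filter_true_of_mem fun v hv => (hVn v hv).exists_emb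
  rw [meanCost, expPi_eq_sum_map_addToOthers (Finset.image_nonempty.1 hV) fun v => hrate v.emb,
    lintegral_finsetSum_measure, Finset.sum_image FinVar.emb_injective.injOn]
  refine Finset.sum_congr rfl fun w hw => ?_
  rw [lintegral_smul_measure, smul_eq_mul, lintegral_matrix_addToOthers hw,
    Finset.sum_image FinVar.emb_injective.injOn]

theorem meanCost_permCols (hm : k ≤ m) (hn : k ≤ n) (π : Equiv.Perm (Fin n))
    (hcoeff : ∀ i (j : Fin n) (v : FinVar q m n),
      F'.coeff i (π j) (FinVar.permCols π v).emb = F.coeff i j v.emb)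
    (hrate : ∀ v : FinVar q m n, F'.rate (FinVar.permCols π v).emb n = F.rate v.emb n) :
    F'.meanCost k n = F.meanCost k n := by
  have hlaw : (expPi fun v : FinVar q m n => F.rate v.emb n) =
      (expPi fun v => F'.rate v.emb n).map fun y v => y (FinVar.permCols π v) := by
    rw [map_expPi_comp_equiv]
    simp only [hrate]
  rw [meanCost, meanCost, hlaw, lintegral_map (measurable_cost ..) (by fun_prop)]
  refine lintegral_congr fun y => ?_
  rw [← minAssignmentSum_comp_perm hm hn _ π]
  congr 2
  ext i j
  rw [matrix, ← Equiv.sum_comp (FinVar.permCols π)]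
  exact Finset.sum_congr rfl fun v _ => by rw [hcoeff]

end ExpFamily

end ExpFamily

section State

/-- A partial matching of rows to columns, in which some matched rows are marked as reached by
alternating paths from unmatched columns. -/
structure Labelling (m : ℕ) where
  /-- The matched rows. -/
  matched : Finset (Fin m)
  /-- The matched rows that have been reached. -/
  reached : Finset (Fin m)
  /-- The column of a matched row. -/
  col : Fin m → ℕ

namespace Labelling

variable {m n : ℕ} {L : Labelling m}

/-- The columns of the matched rows. -/
def matchedCols (L : Labelling m) : Finset ℕ := L.matched.image L.col

/-- The columns of the reached rows. -/
def reachedCols (L : Labelling m) : Finset ℕ := L.reached.image L.col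

/-- The columns of the other matched rows. Together with the reached rows they form the current
partial cover. -/
def coveredCols (L : Labelling m) : Finset ℕ := (L.matched \ L.reached).image L.col

/-- Mark row `i` as reached. -/
def reach (L : Labelling m) (i : Fin m) : Labelling m :=
  { L with reached := insert i L.reached }

/-- Rearrange the matching according to `τ`, match row `i` to column `j`, and forget which rows
were reached. -/
def augment (L : Labelling m) (τ : Fin m → ℕ) (i : Fin m) (j : ℕ) : Labelling m where
  matched := insert i L.matched
  reached := ∅
  col := Function.update τ i j

theorem coveredCols_subset_matchedCols : L.coveredCols ⊆ L.matchedCols :=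
  Finset.image_subset_image Finset.sdiff_subset

theorem notMem_coveredCols_of_notMem {j : ℕ} (hj : j ∉ L.matchedCols) : j ∉ L.coveredCols :=
  fun h => hj (coveredCols_subset_matchedCols h)

theorem mem_reachedCols_of_mem {j : ℕ} (hj : j ∈ L.matchedCols) (hj' : j ∉ L.coveredCols) :
    j ∈ L.reachedCols := by
  obtain ⟨a, ha, rfl⟩ := Finset.mem_image.1 hj
  refine Finset.mem_image_of_mem _ ?_
  by_contra haR
  exact hj' (Finset.mem_image_of_mem _ (Finset.mem_sdiff.2 ⟨ha, haR⟩))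

theorem augment_col_self {τ : Fin m → ℕ} {i : Fin m} {j : ℕ} : (L.augment τ i j).col i = j :=
  Function.update_self ..

theorem augment_col_of_ne {τ : Fin m → ℕ} {a i : Fin m} {j : ℕ} (h : a ≠ i) :
    (L.augment τ i j).col a = τ a :=
  Function.update_of_ne h ..

/-- The matched positions in the `m × n` matrix. -/
def positions (L : Labelling m) (n : ℕ) : Finset (Fin m × Fin n) :=
  {e | e.1 ∈ L.matched ∧ (e.2 : ℕ) = L.col e.1}

theorem mem_positions {e : Fin m × Fin n} :
    e ∈ L.positions n ↔ e.1 ∈ L.matched ∧ (e.2 : ℕ) = L.col e.1 := by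
  rw [positions, Finset.mem_filter_univ]

end Labelling

variable {q m k n n₀ : ℕ}

/-- The entry `(i, j)` is the variable belonging to this position, which has rate 1 and occurs in
no other position. -/
structure ExpFamily.IsStd (F : ExpFamily q m) (i : Fin m) (j : ℕ) : Prop where
  eq_single : F.coeff i j = Pi.single (Sum.inr (i, j)) 1
  rate : ∀ x, F.rate (Sum.inr (i, j)) x = 1
  unique : ∀ i' j', (i', j') ≠ (i, j) → F.coeff i' j' (Sum.inr (i, j)) = 0

/-- `τ` is a matching of the matched rows to zeros that arises from an alternating path ending in
the column `j`, which it leaves free. Only reached rows have moved. -/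
structure IsRearrangement (F : ExpFamily q m) (L : Labelling m) (j : ℕ) (τ : Fin m → ℕ) :
    Prop where
  injOn : Set.InjOn τ L.matched
  eq_col : ∀ a ∈ L.matched \ L.reached, τ a = L.col a
  coeff_eq_zero : ∀ a ∈ L.matched, F.coeff a (τ a) = 0
  ne : ∀ a ∈ L.matched, τ a ≠ j
  col_eq_or_mem : ∀ a ∈ L.matched, L.col a = j ∨ L.col a ∈ L.matched.image τ

/-- A state of the Hungarian algorithm: the positions of the partial matching are zeros, and every
column outside the current cover can be freed by rearranging the matching. -/
structure MatchingState (k n₀ : ℕ) (F : ExpFamily q m) (L : Labelling m) : Prop where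
  nonneg : ∀ i j v, 0 ≤ F.coeff i j v
  kpos : ∀ v, IsKPositive k (F.rate v)
  subset : L.reached ⊆ L.matched
  injOn : Set.InjOn L.col L.matched
  zero : ∀ i ∈ L.matched, F.coeff i (L.col i) = 0
  zero_or_std : ∀ i j, j ∉ L.matchedCols → F.coeff i j = 0 ∨ F.IsStd i j
  std_beyond : ∀ i j, n₀ ≤ j → F.IsStd i j
  exists_rearrangement : ∀ j ∉ L.coveredCols, ∃ τ, IsRearrangement F L j τ

variable {F F' : ExpFamily q m} {L : Labelling m} {i : Fin m} {j : ℕ} {τ : Fin m → ℕ}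

theorem injOn_update_insert {α β : Type*} [DecidableEq α] {f : α → β} {s : Set α} {a : α} {b : β}
    (hf : Set.InjOn f s) (hb : ∀ x ∈ s, f x ≠ b) :
    Set.InjOn (Function.update f a b) (insert a s) := by
  intro x hx y hy hxy
  by_cases hxa : x = a <;> by_cases hya : y = a
  · rw [hxa, hya]
  · rw [hxa, Function.update_self, Function.update_of_ne hya] at hxy
    exact absurd hxy.symm (hb y (hy.resolve_left hya))
  · rw [hya, Function.update_self, Function.update_of_ne hxa] at hxy
    exact absurd hxy (hb x (hx.resolve_left hxa))
  · rw [Function.update_of_ne hxa, Function.update_of_ne hya] at hxy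
    exact hf (hx.resolve_left hxa) (hy.resolve_left hya) hxy

namespace ExpFamily

namespace IsStd

theorem ne_zero (h : F.IsStd i j) : F.coeff i j ≠ 0 := by
  rw [h.eq_single]
  exact Pi.single_ne_zero_iff.2 one_ne_zero

theorem apply_eq_zero (h : F.IsStd i j) {v : Var q m} (hv : v ≠ Sum.inr (i, j)) :
    F.coeff i j v = 0 := by
  rw [h.eq_single, Pi.single_eq_of_ne hv]

theorem replace (h : F.IsStd i j) {w : Var q m} (hw : w ≠ Sum.inr (i, j)) {φ : Fin m → ℕ → ℝ}
    (hφ : φ i j = 0) (g : ℝ → ℝ) : (F.replace w φ g).IsStd i j where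
  eq_single := by
    ext v
    by_cases hv : v = w
    · subst hv
      rw [coeff_replace_self, hφ, Pi.single_eq_of_ne hw]
    · rw [coeff_replace_of_ne F hv, h.eq_single]
  rate x := by rw [rate_replace_of_ne F hw.symm, h.rate]
  unique i' j' hne := by rw [coeff_replace_of_ne F hw.symm, h.unique i' j' hne]

end IsStd

end ExpFamily

namespace IsRearrangement

theorem of_col (hinj : Set.InjOn L.col L.matched)
    (hzero : ∀ i ∈ L.matched, F.coeff i (L.col i) = 0) (hj : j ∉ L.matchedCols) :
    IsRearrangement F L j L.col where
  injOn := hinj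
  eq_col _ _ := rfl
  coeff_eq_zero := hzero
  ne _ ha e := hj (Finset.mem_image.2 ⟨_, ha, e⟩)
  col_eq_or_mem _ ha := Or.inr (Finset.mem_image_of_mem _ ha)

theorem reach_of_mem (h : IsRearrangement F L j τ) (i : Fin m) :
    IsRearrangement F (L.reach i) j τ where
  injOn := h.injOn
  eq_col a ha :=
    h.eq_col a (Finset.sdiff_subset_sdiff le_rfl (Finset.subset_insert i L.reached) ha)
  coeff_eq_zero := h.coeff_eq_zero
  ne := h.ne
  col_eq_or_mem := h.col_eq_or_mem

theorem reach (h : IsRearrangement F L j τ) (hcol : Set.InjOn L.col L.matched)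
    (hi : i ∈ L.matched) (hiR : i ∉ L.reached) (hj : j ∉ L.coveredCols) (h0 : F.coeff i j = 0) :
    IsRearrangement F (L.reach i) (L.col i) (Function.update τ i j) where
  injOn := (injOn_update_insert h.injOn h.ne).mono (Set.subset_insert _ _)
  eq_col a ha := by
    obtain ⟨haI, haR⟩ := Finset.mem_sdiff.1 ha
    obtain ⟨hai, haR⟩ := not_or.1 (Finset.mem_insert.not.1 haR)
    rw [Function.update_of_ne hai]
    exact h.eq_col a (Finset.mem_sdiff.2 ⟨haI, haR⟩)
  coeff_eq_zero a ha := by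
    by_cases hai : a = i
    · subst hai; rwa [Function.update_self]
    · rw [Function.update_of_ne hai]; exact h.coeff_eq_zero a ha
  ne a ha := by
    have hmem : i ∈ L.matched \ L.reached := Finset.mem_sdiff.2 ⟨hi, hiR⟩
    by_cases hai : a = i
    · subst hai
      rw [Function.update_self]
      exact fun e => hj (Finset.mem_image.2 ⟨a, hmem, e.symm⟩)
    · rw [Function.update_of_ne hai]
      exact fun e => hai (h.injOn ha hi (e.trans (h.eq_col i hmem).symm))
  col_eq_or_mem a ha := by
    by_cases hai : a = i
    · exact Or.inl (by rw [hai]; rfl)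
    right
    rcases h.col_eq_or_mem a ha with h' | h'
    · exact Finset.mem_image.2 ⟨i, hi, by rw [Function.update_self, ← h']; rfl⟩
    · obtain ⟨b, hb, hba⟩ := Finset.mem_image.1 h'
      refine Finset.mem_image.2 ⟨b, hb, ?_⟩
      rw [Function.update_of_ne, hba]
      · rfl
      · rintro rfl
        rw [h.eq_col b (Finset.mem_sdiff.2 ⟨hi, hiR⟩)] at hba
        exact hai (hcol ha hi hba.symm)

theorem replace {w : Var q m} {φ : Fin m → ℕ → ℝ} (h : IsRearrangement F L j τ)
    (hsub : L.reached ⊆ L.matched)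
    (hφ : ∀ i j, F.coeff i j = 0 → ¬ (i ∈ L.reached ∧ j ∈ L.coveredCols) → φ i j = 0)
    (g : ℝ → ℝ) : IsRearrangement (F.replace w φ g) L j τ where
  injOn := h.injOn
  eq_col := h.eq_col
  coeff_eq_zero a ha := by
    refine ExpFamily.coeff_replace_eq_zero (h.coeff_eq_zero a ha) (hφ a _ (h.coeff_eq_zero a ha) ?_)
    rintro ⟨haR, hmem⟩
    obtain ⟨b, hb, hba⟩ := Finset.mem_image.1 hmem
    rw [← h.eq_col b hb] at hba
    rw [Finset.mem_sdiff] at hb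
    exact hb.2 (h.injOn hb.1 (hsub haR) hba ▸ haR)
  ne := h.ne
  col_eq_or_mem := h.col_eq_or_mem

theorem injOn_augment (h : IsRearrangement F L j τ) :
    Set.InjOn (L.augment τ i j).col (L.augment τ i j).matched := by
  rw [Labelling.augment, Finset.coe_insert]
  exact injOn_update_insert h.injOn h.ne

theorem coeff_augment (h : IsRearrangement F L j τ) (h0 : F.coeff i j = 0) :
    ∀ a ∈ (L.augment τ i j).matched, F.coeff a ((L.augment τ i j).col a) = 0 := by
  intro a ha
  by_cases hai : a = i
  · subst hai; rwa [Labelling.augment_col_self]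
  · rw [Labelling.augment_col_of_ne hai]
    exact h.coeff_eq_zero a ((Finset.mem_insert.1 ha).resolve_left hai)

theorem matchedCols_subset_augment (h : IsRearrangement F L j τ) (hi : i ∉ L.matched) :
    L.matchedCols ⊆ (L.augment τ i j).matchedCols := by
  intro b hb
  obtain ⟨d, hd, rfl⟩ := Finset.mem_image.1 hb
  rcases h.col_eq_or_mem d hd with hdj | hdτ
  · rw [hdj]
    exact Finset.mem_image.2 ⟨i, Finset.mem_insert_self _ _, Labelling.augment_col_self⟩
  · obtain ⟨a, ha, hab⟩ := Finset.mem_image.1 hdτ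
    refine Finset.mem_image.2 ⟨a, Finset.mem_insert_of_mem ha, ?_⟩
    rw [Labelling.augment_col_of_ne (ne_of_mem_of_not_mem ha hi), hab]

end IsRearrangement

namespace MatchingState

theorem col_lt (S : MatchingState k n₀ F L) (hi : i ∈ L.matched) : L.col i < n₀ := by
  by_contra! h
  exact (S.std_beyond i _ h).ne_zero (S.zero i hi)

theorem lt_of_mem_matchedCols (S : MatchingState k n₀ F L) (h : j ∈ L.matchedCols) : j < n₀ := by
  obtain ⟨i, hi, rfl⟩ := Finset.mem_image.1 h
  exact S.col_lt hi

theorem notMem_matchedCols_of_le (S : MatchingState k n₀ F L) (h : n₀ ≤ j) :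
    j ∉ L.matchedCols :=
  fun hj => absurd (S.lt_of_mem_matchedCols hj) (not_lt.2 h)

theorem mem_matchedCols_of_mem_reachedCols (S : MatchingState k n₀ F L) (h : j ∈ L.reachedCols) :
    j ∈ L.matchedCols :=
  Finset.image_subset_image S.subset h

theorem col_notMem_coveredCols (S : MatchingState k n₀ F L) (hi : i ∈ L.reached) :
    L.col i ∉ L.coveredCols := by
  intro h
  obtain ⟨a, ha, hai⟩ := Finset.mem_image.1 h
  rw [Finset.mem_sdiff] at ha
  exact ha.2 (S.injOn ha.1 (S.subset hi) hai ▸ hi)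

theorem notMem_coveredCols_of_mem_reachedCols (S : MatchingState k n₀ F L)
    (h : j ∈ L.reachedCols) : j ∉ L.coveredCols := by
  obtain ⟨i, hi, rfl⟩ := Finset.mem_image.1 h
  exact S.col_notMem_coveredCols hi

theorem reach (S : MatchingState k n₀ F L) (hi : i ∈ L.matched) (hiR : i ∉ L.reached)
    (hj : j ∉ L.coveredCols) (h0 : F.coeff i j = 0) : MatchingState k n₀ F (L.reach i) where
  nonneg := S.nonneg
  kpos := S.kpos
  subset := Finset.insert_subset hi S.subset
  injOn := S.injOn
  zero := S.zero
  zero_or_std := S.zero_or_std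
  std_beyond := S.std_beyond
  exists_rearrangement j' hj' := by
    by_cases hj'L : j' ∈ L.coveredCols
    · obtain rfl : j' = L.col i := by
        obtain ⟨a, ha, rfl⟩ := Finset.mem_image.1 hj'L
        rw [Finset.mem_sdiff] at ha
        by_contra hne
        refine hj' (Finset.mem_image.2 ⟨a, Finset.mem_sdiff.2 ⟨ha.1, fun h => ?_⟩, rfl⟩)
        exact (Finset.mem_insert.1 h).elim (fun e => hne (by rw [e])) ha.2
      obtain ⟨τ, hτ⟩ := S.exists_rearrangement j hj
      exact ⟨_, hτ.reach S.injOn hi hiR hj h0⟩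
    · obtain ⟨τ, hτ⟩ := S.exists_rearrangement j' hj'L
      exact ⟨τ, hτ.reach_of_mem i⟩

theorem exists_augment (S : MatchingState k n₀ F L) (hi : i ∉ L.matched)
    (hj : j ∉ L.coveredCols) (h0 : F.coeff i j = 0) :
    ∃ τ, MatchingState k n₀ F (L.augment τ i j) := by
  obtain ⟨τ, hτ⟩ := S.exists_rearrangement j hj
  refine ⟨τ, S.nonneg, S.kpos, Finset.empty_subset _, hτ.injOn_augment, hτ.coeff_augment h0,
    fun a b hb => S.zero_or_std a b fun h => hb (hτ.matchedCols_subset_augment hi h),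
    S.std_beyond, fun b hb => ⟨_, .of_col hτ.injOn_augment (hτ.coeff_augment h0) ?_⟩⟩
  rwa [Labelling.coveredCols, show (L.augment τ i j).reached = ∅ from rfl, Finset.sdiff_empty] at hb

/-- The variable does not belong to a standard position in an unmatched column. -/
def Free (F : ExpFamily q m) (L : Labelling m) (v : Var q m) : Prop :=
  ∀ i j, j ∉ L.matchedCols → F.IsStd i j → v ≠ Sum.inr (i, j)

theorem free_of_ne_zero (hj : j ∈ L.matchedCols) {v : Var q m} (hv : F.coeff i j v ≠ 0) :
    Free F L v := by
  rintro i' j' hj' hstd rfl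
  refine hv (hstd.unique i j fun e => hj' ?_)
  exact (Prod.mk.inj e).2 ▸ hj

theorem Free.below (S : MatchingState k n₀ F L) {v : Var q m} (hv : Free F L v) :
    v.Below n₀ := by
  intro i j e
  by_contra! h
  exact hv i j (S.notMem_matchedCols_of_le h) (S.std_beyond i j h) e

theorem replace (S : MatchingState k n₀ F L) {n₁ : ℕ} (hn : n₀ ≤ n₁) {w : Var q m}
    (hw : w.Below n₁) {φ : Fin m → ℕ → ℝ} {g : ℝ → ℝ} (hφ : ∀ i j, 0 ≤ φ i j)
    (hg : IsKPositive k g)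
    (hzero : ∀ i j, F.coeff i j = 0 → ¬ (i ∈ L.reached ∧ j ∈ L.coveredCols) → φ i j = 0)
    (hstd : ∀ i j, j ∉ L.matchedCols → F.IsStd i j → φ i j = 0) :
    MatchingState k n₁ (F.replace w φ g) L where
  nonneg i j v := by
    by_cases hv : v = w
    · subst hv; rw [ExpFamily.coeff_replace_self]; exact hφ i j
    · rw [ExpFamily.coeff_replace_of_ne F hv]; exact S.nonneg i j v
  kpos v := by
    by_cases hv : v = w
    · subst hv; rwa [ExpFamily.rate_replace_self]
    · rw [ExpFamily.rate_replace_of_ne F hv]; exact S.kpos v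
  subset := S.subset
  injOn := S.injOn
  zero i hi := ExpFamily.coeff_replace_eq_zero (S.zero i hi) <|
    hzero i _ (S.zero i hi) fun h => S.col_notMem_coveredCols h.1 h.2
  zero_or_std i j hj := by
    rcases S.zero_or_std i j hj with h | h
    · exact Or.inl (ExpFamily.coeff_replace_eq_zero h
        (hzero i j h fun h' => Labelling.notMem_coveredCols_of_notMem hj h'.2))
    · by_cases hwe : w = Sum.inr (i, j)
      · left
        ext v
        by_cases hv : v = w
        · subst hv; rw [ExpFamily.coeff_replace_self]; exact hstd i j hj h
        · rw [ExpFamily.coeff_replace_of_ne F hv]; exact h.apply_eq_zero (hwe ▸ hv)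
      · exact Or.inr (h.replace hwe (hstd i j hj h) g)
  std_beyond i j hj := by
    have h := S.std_beyond i j (hn.trans hj)
    refine h.replace (fun e => absurd (hw i j e) (not_lt.2 hj)) (hstd i j ?_ h) g
    exact S.notMem_matchedCols_of_le (hn.trans hj)
  exists_rearrangement j hj :=
    (S.exists_rearrangement j hj).imp fun _ hτ => hτ.replace S.subset hzero g

theorem mk_mem_positions (S : MatchingState k n₀ F L) (hn : n₀ ≤ n) (hi : i ∈ L.matched) :
    (i, ⟨L.col i, (S.col_lt hi).trans_le hn⟩) ∈ L.positions n :=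
  Labelling.mem_positions.2 ⟨hi, rfl⟩

theorem isAssignment_positions (S : MatchingState k n₀ F L) (hn : n₀ ≤ n) :
    IsAssignment L.matched.card (L.positions n) := by
  constructor
  · symm
    refine Finset.card_bij (fun i hi => _) (fun i hi => S.mk_mem_positions hn hi) ?_ ?_
    · intro a _ b _ hab
      exact (Prod.mk.inj hab).1
    · rintro ⟨a, b⟩ hab
      rw [Labelling.mem_positions] at hab
      exact ⟨a, hab.1, Prod.ext rfl (Fin.ext hab.2.symm)⟩
  · rintro ⟨a, b⟩ hab ⟨a', b'⟩ hab' hne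
    rw [Labelling.mem_positions] at hab hab'
    have haa : a ≠ a' := by
      rintro rfl
      exact hne (Prod.ext rfl (Fin.ext (hab.2.trans hab'.2.symm)))
    refine ⟨haa, fun e => haa (S.injOn hab.1 hab'.1 ?_)⟩
    rw [← hab.2, ← hab'.2]
    exact congrArg Fin.val e

theorem matrix_eq_zero (S : MatchingState k n₀ F L) (y : FinVar q m n → ℝ) {e : Fin m × Fin n}
    (he : e ∈ L.positions n) : F.matrix n y e.1 e.2 = 0 := by
  rw [Labelling.mem_positions] at he
  simp [ExpFamily.matrix, he.2, S.zero e.1 he.1]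

theorem meanCost_eq_zero (S : MatchingState k n₀ F L) (hn : n₀ ≤ n) (hk : k ≤ L.matched.card) :
    F.meanCost k n = 0 := by
  rw [ExpFamily.meanCost, lintegral_congr_ae (g := fun _ => 0), lintegral_zero]
  filter_upwards [ae_nonneg_expPi fun v : FinVar q m n => F.rate v.emb n] with y hy
  rw [minAssignmentSum_eq_zero (ExpFamily.matrix_nonneg S.nonneg hy)
    (S.isAssignment_positions hn) hk fun e he => S.matrix_eq_zero y he, ENNReal.ofReal_zero]

end MatchingState

end State

section Step

variable {q m k n n₀ : ℕ} {F : ExpFamily q m} {L : Labelling m} {O : Finset (Var q m)} {i : Fin m}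
  {j : ℕ}

/-- The uncovered positions in the unmatched columns of a matrix with `n` columns, as variables. -/
def Labelling.uncoveredVars (q n : ℕ) (L : Labelling m) : Finset (Var q m) :=
  (L.reachedᶜ ×ˢ (Finset.range n \ L.matchedCols)).map ⟨Sum.inr, Sum.inr_injective⟩

theorem Labelling.mem_uncoveredVars {v : Var q m} : v ∈ L.uncoveredVars q n ↔
    ∃ i j, i ∉ L.reached ∧ j < n ∧ j ∉ L.matchedCols ∧ v = Sum.inr (i, j) := by
  simp only [uncoveredVars, Finset.mem_map, Finset.mem_product, Finset.mem_compl,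
    Finset.mem_sdiff, Finset.mem_range, Function.Embedding.coeFn_mk, Prod.exists, and_assoc,
    eq_comm]

namespace ExpFamily

/-- The coefficient of the minimum `t` of the standard variables in uncovered positions and the
variables in `O`, after `t` is subtracted from the uncovered entries and added to the doubly
covered ones. -/
noncomputable def stepCoeff (F : ExpFamily q m) (L : Labelling m) (O : Finset (Var q m))
    (i : Fin m) (j : ℕ) : ℝ :=
  (if i ∉ L.reached ∧ j ∉ L.matchedCols then 1 else ∑ v ∈ O, F.coeff i j v) -
    (1 - (if i ∈ L.reached then 1 else 0) - (if j ∈ L.coveredCols then 1 else 0))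

/-- The rate of the minimum of the standard variables in uncovered positions and the variables
in `O`. -/
noncomputable def stepRate (F : ExpFamily q m) (L : Labelling m) (O : Finset (Var q m)) (x : ℝ) :
    ℝ :=
  ((m - L.reached.card : ℕ) : ℝ) * (x - L.matched.card) + ∑ v ∈ O, F.rate v x

/-- The family after a step of the Hungarian algorithm in which the minimal variable is `w`. -/
noncomputable def dualStep (F : ExpFamily q m) (L : Labelling m) (O : Finset (Var q m))
    (w : Var q m) : ExpFamily q m :=
  F.replace w (F.stepCoeff L O) (F.stepRate L O)

/-- The conditions for a step: no uncovered position is identically zero, and each uncovered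
entry in a matched column is at least the sum of the variables in `O`. -/
structure Steppable (F : ExpFamily q m) (L : Labelling m) (O : Finset (Var q m)) : Prop where
  ne_zero : ∀ i j, i ∉ L.reached → j ∉ L.coveredCols → F.coeff i j ≠ 0
  free : ∀ v ∈ O, MatchingState.Free F L v
  one_le : ∀ i j, i ∉ L.reached → j ∈ L.reachedCols → 1 ≤ ∑ v ∈ O, F.coeff i j v

namespace Steppable

theorem sum_coeff_eq_zero (T : F.Steppable L O) (hj : j ∉ L.matchedCols) (h : F.IsStd i j) :
    ∑ v ∈ O, F.coeff i j v = 0 :=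
  Finset.sum_eq_zero fun v hv => h.apply_eq_zero (T.free v hv i j hj h)

theorem stepCoeff_of_zero (T : F.Steppable L O) (h : F.coeff i j = 0)
    (hd : ¬ (i ∈ L.reached ∧ j ∈ L.coveredCols)) : F.stepCoeff L O i j = 0 := by
  have h0 : ∑ v ∈ O, F.coeff i j v = 0 := by simp [h]
  unfold stepCoeff
  by_cases hi : i ∈ L.reached
  · have hj : j ∉ L.coveredCols := fun hj => hd ⟨hi, hj⟩
    simp [hi, hj, h0]
  · by_cases hj : j ∈ L.coveredCols
    · simp [hi, hj, Labelling.coveredCols_subset_matchedCols hj, h0]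
    · exact absurd h (T.ne_zero i j hi hj)

theorem stepCoeff_of_std (T : F.Steppable L O) (hj : j ∉ L.matchedCols) (h : F.IsStd i j) :
    F.stepCoeff L O i j = 0 := by
  unfold stepCoeff
  by_cases hi : i ∈ L.reached <;>
    simp [hi, hj, Labelling.notMem_coveredCols_of_notMem hj, T.sum_coeff_eq_zero hj h]

end Steppable

end ExpFamily

namespace MatchingState

open ExpFamily

theorem isKPositive_stepRate (S : MatchingState k n₀ F L) (hk : L.matched.card < k)
    (hm : L.reached.card < m) : IsKPositive k (F.stepRate L O) := by
  classical
  unfold stepRate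
  induction O using Finset.induction_on with
  | empty => simpa using isKPositive_mul_sub (Nat.sub_pos_of_lt hm) hk
  | insert v s hv ih =>
    simpa only [Finset.sum_insert hv, add_assoc, add_comm (F.rate v _)] using ih.add (S.kpos v)

theorem stepRate_pos (S : MatchingState k n₀ F L) (hk : L.matched.card < k)
    (hm : L.reached.card < m) (hkn : k ≤ n) : 0 < F.stepRate L O n :=
  (S.isKPositive_stepRate hk hm).2 n (by exact_mod_cast hkn)

theorem isStd_of_uncovered (S : MatchingState k n₀ F L) (T : F.Steppable L O)
    (hi : i ∉ L.reached) (hj : j ∉ L.matchedCols) : F.IsStd i j :=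
  (S.zero_or_std i j hj).resolve_left
    (T.ne_zero i j hi (Labelling.notMem_coveredCols_of_notMem hj))

theorem stepCoeff_nonneg (S : MatchingState k n₀ F L) (T : F.Steppable L O) (i : Fin m) (j : ℕ) :
    0 ≤ F.stepCoeff L O i j := by
  have h0 : 0 ≤ ∑ v ∈ O, F.coeff i j v := Finset.sum_nonneg fun v _ => S.nonneg i j v
  unfold stepCoeff
  by_cases hi : i ∈ L.reached <;> by_cases hj : j ∈ L.coveredCols <;>
    by_cases hjL : j ∈ L.matchedCols <;>
    simp only [hi, hj, hjL, not_true_eq_false, not_false_eq_true, if_true, if_false, and_true,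
      and_false] <;> try linarith
  linarith [T.one_le i j hi (Labelling.mem_reachedCols_of_mem hjL hj)]

theorem dualStep (S : MatchingState k n₀ F L) (T : F.Steppable L O) (hk : L.matched.card < k)
    (hm : L.reached.card < m) {n₁ : ℕ} (hn : n₀ ≤ n₁) {w : Var q m} (hw : w.Below n₁) :
    MatchingState k n₁ (F.dualStep L O w) L :=
  S.replace hn hw (S.stepCoeff_nonneg T) (S.isKPositive_stepRate hk hm)
    (fun _ _ => T.stepCoeff_of_zero) fun _ _ => T.stepCoeff_of_std

theorem coeff_dualStep_eq_zero (S : MatchingState k n₀ F L) (T : F.Steppable L O)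
    (hi : i ∉ L.reached) (hj : j ∉ L.matchedCols) :
    (F.dualStep L O (Sum.inr (i, j))).coeff i j = 0 := by
  have h := S.isStd_of_uncovered T hi hj
  ext v
  by_cases hv : v = Sum.inr (i, j)
  · subst hv
    exact (coeff_replace_self ..).trans (T.stepCoeff_of_std hj h)
  · exact (coeff_replace_of_ne F hv ..).trans (h.apply_eq_zero hv)

theorem disjoint_uncoveredVars (S : MatchingState k n₀ F L) (T : F.Steppable L O) (n : ℕ) :
    Disjoint O (L.uncoveredVars q n) := by
  rw [Finset.disjoint_left]
  intro v hv hmem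
  obtain ⟨i, j, hi, -, hj, rfl⟩ := Labelling.mem_uncoveredVars.1 hmem
  exact T.free _ hv i j hj (S.isStd_of_uncovered T hi hj) rfl

theorem sum_coeff_uncoveredVars (S : MatchingState k n₀ F L) (T : F.Steppable L O) (hj : j < n) :
    ∑ u ∈ L.uncoveredVars q n, F.coeff i j u =
      if i ∉ L.reached ∧ j ∉ L.matchedCols then 1 else 0 := by
  have hother : ∀ v ∈ L.uncoveredVars q n, v ≠ Sum.inr (i, j) → F.coeff i j v = 0 := by
    intro v hv hne
    obtain ⟨a, b, ha, -, hb, rfl⟩ := Labelling.mem_uncoveredVars.1 hv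
    exact (S.isStd_of_uncovered T ha hb).unique i j fun e => hne (by rw [e])
  by_cases h : i ∉ L.reached ∧ j ∉ L.matchedCols
  · rw [if_pos h, Finset.sum_eq_single_of_mem _
      (Labelling.mem_uncoveredVars.2 ⟨i, j, h.1, hj, h.2, rfl⟩) hother,
      (S.isStd_of_uncovered T h.1 h.2).eq_single, Pi.single_eq_same]
  · rw [if_neg h]
    refine Finset.sum_eq_zero fun v hv => hother v hv ?_
    rintro rfl
    obtain ⟨a, b, ha, -, hb, e⟩ := Labelling.mem_uncoveredVars.1 hv
    obtain ⟨rfl, rfl⟩ := Prod.mk.inj (Sum.inr_injective e)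
    exact h ⟨ha, hb⟩

theorem sum_coeff_eq (S : MatchingState k n₀ F L) (T : F.Steppable L O) (i : Fin m) (hj : j < n) :
    ∑ u ∈ O ∪ L.uncoveredVars q n, F.coeff i j u =
      if i ∉ L.reached ∧ j ∉ L.matchedCols then 1 else ∑ v ∈ O, F.coeff i j v := by
  rw [Finset.sum_union (S.disjoint_uncoveredVars T n), S.sum_coeff_uncoveredVars T hj]
  split_ifs with h
  · rw [T.sum_coeff_eq_zero h.2 (S.isStd_of_uncovered T h.1 h.2), zero_add]
  · rw [add_zero]

theorem card_matchedCols (S : MatchingState k n₀ F L) : L.matchedCols.card = L.matched.card :=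
  Finset.card_image_of_injOn S.injOn

theorem matchedCols_subset_range (S : MatchingState k n₀ F L) (hn : n₀ ≤ n) :
    L.matchedCols ⊆ Finset.range n :=
  fun _ hj => Finset.mem_range.2 ((S.lt_of_mem_matchedCols hj).trans_le hn)

theorem sum_rate_eq (S : MatchingState k n₀ F L) (T : F.Steppable L O) (hn : n₀ ≤ n) :
    ∑ u ∈ O ∪ L.uncoveredVars q n, F.rate u n = F.stepRate L O n := by
  have hsub := S.matchedCols_subset_range hn
  have hle : L.matched.card ≤ n := by
    simpa only [S.card_matchedCols, Finset.card_range] using Finset.card_le_card hsub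
  have hone : ∀ v ∈ L.uncoveredVars q n, F.rate v n = 1 := fun v hv => by
    obtain ⟨i, j, hi, -, hj, rfl⟩ := Labelling.mem_uncoveredVars.1 hv
    exact (S.isStd_of_uncovered T hi hj).rate n
  rw [Finset.sum_union (S.disjoint_uncoveredVars T n), Finset.sum_congr rfl hone,
    Finset.sum_const, nsmul_eq_mul, mul_one, Labelling.uncoveredVars, Finset.card_map,
    Finset.card_product, Finset.card_sdiff_of_subset hsub, S.card_matchedCols,
    Finset.card_compl, Fintype.card_fin, Finset.card_range, stepRate, Nat.cast_mul,
    Nat.cast_sub hle, add_comm]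

theorem card_filter_coveredCols (S : MatchingState k n₀ F L) (hn : n₀ ≤ n) :
    (Finset.univ.filter fun j : Fin n => (j : ℕ) ∈ L.coveredCols).card =
      (L.matched \ L.reached).card := by
  have hlt : ∀ j ∈ L.coveredCols, j < n := fun j hj => (S.lt_of_mem_matchedCols
    (Labelling.coveredCols_subset_matchedCols hj)).trans_le hn
  rw [← Finset.card_image_of_injOn (S.injOn.mono (Finset.coe_subset.2 Finset.sdiff_subset))]
  exact Finset.card_bij (fun j _ => (j : ℕ)) (fun j hj => (Finset.mem_filter.1 hj).2)
    (fun a _ b _ h => Fin.val_injective h)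
    fun j hj => ⟨⟨j, hlt j hj⟩, Finset.mem_filter.2 ⟨Finset.mem_univ _, hj⟩, rfl⟩

theorem matrix_conditionMin (S : MatchingState k n₀ F L) (T : F.Steppable L O)
    (w : FinVar q m n) (y : FinVar q m n → ℝ) (i : Fin m) (j : Fin n) :
    (F.conditionMin (O ∪ L.uncoveredVars q n) w.emb).matrix n y i j =
      (F.dualStep L O w.emb).matrix n y i j + y w * (1 - (if i ∈ L.reached then 1 else 0) -
        (if j ∈ Finset.univ.filter fun j : Fin n => (j : ℕ) ∈ L.coveredCols then 1 else 0)) := by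
  rw [conditionMin, ExpFamily.dualStep, matrix_replace, matrix_replace, S.sum_coeff_eq T i j.2,
    stepCoeff]
  simp only [Finset.mem_filter_univ]
  ring

theorem minAssignmentSum_conditionMin (S : MatchingState k n₀ F L) (T : F.Steppable L O)
    (hk : L.matched.card < k) (hm : L.reached.card < m) (hkm : k ≤ m) (hkn : k ≤ n) (hn : n₀ ≤ n)
    (w : FinVar q m n) (hw : w.emb.Below n) {y : FinVar q m n → ℝ} (hy : ∀ v, 0 ≤ y v) :
    minAssignmentSum k ((F.conditionMin (O ∪ L.uncoveredVars q n) w.emb).matrix n y) =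
      minAssignmentSum k ((F.dualStep L O w.emb).matrix n y) + y w * (k - L.matched.card) := by
  have S' := S.dualStep T hk hm hn hw
  rw [show (F.conditionMin _ w.emb).matrix n y = _ from
    funext fun i => funext (S.matrix_conditionMin T w y i)]
  refine minAssignmentSum_eq_add_mul hkm hkn (matrix_nonneg S'.nonneg hy) (hy w)
    (S.isAssignment_positions hn) hk.le (fun e he => S'.matrix_eq_zero y he) ?_ ?_ ?_
  · intro i hi
    exact Finset.mem_image.2 ⟨_, S.mk_mem_positions hn (S.subset hi), rfl⟩
  · intro j hj
    obtain ⟨i, hi, hij⟩ := Finset.mem_image.1 (Finset.mem_filter.1 hj).2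
    exact Finset.mem_image.2 ⟨_, S.mk_mem_positions hn (Finset.mem_sdiff.1 hi).1, Fin.ext hij⟩
  · rw [S.card_filter_coveredCols hn, Finset.card_sdiff_of_subset S.subset]
    exact Nat.add_sub_of_le (Finset.card_le_card S.subset)

theorem meanCost_conditionMin (S : MatchingState k n₀ F L) (T : F.Steppable L O)
    (hk : L.matched.card < k) (hm : L.reached.card < m) (hkm : k ≤ m) (hkn : k ≤ n) (hn : n₀ ≤ n)
    {w : Var q m} (hw : w.Below n) :
    (F.conditionMin (O ∪ L.uncoveredVars q n) w).meanCost k n = (F.dualStep L O w).meanCost k n +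
      ENNReal.ofReal ((k - L.matched.card) / F.stepRate L O n) := by
  have S' := S.dualStep T hk hm hn hw
  obtain ⟨u, rfl⟩ := hw.exists_emb
  have hr : (fun v : FinVar q m n => (F.conditionMin (O ∪ L.uncoveredVars q n) u.emb).rate v.emb n)
      = fun v => (F.dualStep L O u.emb).rate v.emb n := by
    rw [conditionMin, ExpFamily.dualStep, rate_replace_emb, rate_replace_emb, S.sum_rate_eq T hn]
  have hpos : ∀ v : FinVar q m n, 0 < (F.dualStep L O u.emb).rate v.emb n :=
    fun v => (S'.kpos _).2 n (by exact_mod_cast hkn)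
  have hd : (0 : ℝ) ≤ k - L.matched.card := sub_nonneg.2 (by exact_mod_cast hk.le)
  have hmean : ∫⁻ y, ENNReal.ofReal (y u * (k - L.matched.card))
      ∂expPi (fun v : FinVar q m n => (F.dualStep L O u.emb).rate v.emb n) =
      ENNReal.ofReal ((k - L.matched.card) / F.stepRate L O n) := by
    simp only [ENNReal.ofReal_mul' hd]
    rw [lintegral_mul_const _ (by fun_prop), lintegral_ofReal_eval_expPi hpos,
      ExpFamily.dualStep, rate_replace_self, ← ENNReal.ofReal_mul' hd, one_div_mul_eq_div]
  rw [meanCost, meanCost, hr, ← hmean, ← lintegral_add_left (measurable_cost ..)]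
  refine lintegral_congr_ae ?_
  filter_upwards [ae_nonneg_expPi fun v : FinVar q m n => (F.dualStep L O u.emb).rate v.emb n]
    with y hy
  rw [S.minAssignmentSum_conditionMin T hk hm hkm hkn hn u hw hy, ENNReal.ofReal_add
    (minAssignmentSum_nonneg (matrix_nonneg S'.nonneg hy)) (mul_nonneg (hy u) hd)]

theorem below_of_mem (S : MatchingState k n₀ F L) (T : F.Steppable L O) (hn : n₀ ≤ n) {v : Var q m}
    (hv : v ∈ O ∪ L.uncoveredVars q n) : v.Below n := by
  rcases Finset.mem_union.1 hv with hv | hv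
  · exact (Free.below S (T.free v hv)).mono hn
  · obtain ⟨i, j, -, hj, -, rfl⟩ := Labelling.mem_uncoveredVars.1 hv
    rintro a b hab
    exact (Prod.mk.inj (Sum.inr_injective hab)).2 ▸ hj

theorem meanCost_eq_sum_dualStep (S : MatchingState k n₀ F L) (T : F.Steppable L O)
    (hk : L.matched.card < k) (hm : L.reached.card < m) (hkm : k ≤ m) (hkn : k ≤ n)
    (hn : n₀ ≤ n) :
    F.meanCost k n = ∑ w ∈ O ∪ L.uncoveredVars q n,
      ENNReal.ofReal (F.rate w n / F.stepRate L O n) * ((F.dualStep L O w).meanCost k n +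
        ENNReal.ofReal ((k - L.matched.card) / F.stepRate L O n)) := by
  have hsum := S.sum_rate_eq T hn
  have hne : (O ∪ L.uncoveredVars q n).Nonempty :=
    Finset.nonempty_of_sum_ne_zero (hsum.trans_ne (S.stepRate_pos hk hm hkn).ne')
  rw [meanCost_eq_sum_conditionMin hne (fun v => S.below_of_mem T hn)
    fun v => (S.kpos v).2 n (by exact_mod_cast hkn), hsum]
  exact Finset.sum_congr rfl fun w hw => by
    rw [S.meanCost_conditionMin T hk hm hkm hkn hn (S.below_of_mem T hn hw)]

end MatchingState

end Step

section Exchangeability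

variable {q m k n n₀ : ℕ} {F : ExpFamily q m} {L : Labelling m} {O : Finset (Var q m)}
  {π : Equiv.Perm (Fin n)}

theorem le_perm_of_forall_lt (hπ : ∀ l : Fin n, (l : ℕ) < n₀ → π l = l) {l : Fin n}
    (hl : n₀ ≤ (l : ℕ)) : n₀ ≤ (π l : ℕ) := by
  by_contra! h
  have := π.injective (hπ _ h)
  omega

/-- The contribution to the mean cost of the event that `w` is the minimal variable in a step. -/
noncomputable def ExpFamily.stepTerm (F : ExpFamily q m) (k : ℕ) (L : Labelling m)
    (O : Finset (Var q m)) (w : Var q m) (n : ℕ) : ℝ≥0∞ :=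
  ENNReal.ofReal (F.rate w n / F.stepRate L O n) * ((F.dualStep L O w).meanCost k n +
    ENNReal.ofReal ((k - L.matched.card) / F.stepRate L O n))

namespace MatchingState

open ExpFamily

theorem coeff_permCols (S : MatchingState k n₀ F L)
    (hπ : ∀ l : Fin n, (l : ℕ) < n₀ → π l = l) (i : Fin m) (l : Fin n) (v : FinVar q m n) :
    F.coeff i (π l) (FinVar.permCols π v).emb = F.coeff i l v.emb := by
  rcases lt_or_ge (l : ℕ) n₀ with hl | hl
  · rw [hπ l hl]
    rcases v with v | ⟨a, x⟩
    · rfl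
    rcases lt_or_ge (x : ℕ) n₀ with hx | hx
    · exact congrArg (fun x : Fin n => F.coeff i l (Sum.inr (a, x))) (hπ x hx)
    · have hπx := le_perm_of_forall_lt hπ hx
      exact ((S.std_beyond a _ hπx).unique i l fun e => by
        have := (Prod.mk.inj e).2; omega).trans
          ((S.std_beyond a x hx).unique i l fun e => by have := (Prod.mk.inj e).2; omega).symm
  · rw [(S.std_beyond i l hl).eq_single,
      (S.std_beyond i (π l) (le_perm_of_forall_lt hπ hl)).eq_single]
    rcases v with v | ⟨a, x⟩
    · rfl
    · simp [FinVar.permCols, FinVar.emb, Pi.single_apply, Fin.val_inj]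

theorem rate_permCols (S : MatchingState k n₀ F L)
    (hπ : ∀ l : Fin n, (l : ℕ) < n₀ → π l = l) (v : FinVar q m n) :
    F.rate (FinVar.permCols π v).emb = F.rate v.emb := by
  rcases v with v | ⟨a, x⟩
  · rfl
  rcases lt_or_ge (x : ℕ) n₀ with hx | hx
  · exact congrArg (fun x : Fin n => F.rate (Sum.inr (a, x))) (hπ x hx)
  · ext t
    exact ((S.std_beyond a _ (le_perm_of_forall_lt hπ hx)).rate t).trans
      ((S.std_beyond a x hx).rate t).symm

theorem stepCoeff_perm (S : MatchingState k n₀ F L) (T : F.Steppable L O)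
    (hπ : ∀ l : Fin n, (l : ℕ) < n₀ → π l = l) (i : Fin m) (l : Fin n) :
    F.stepCoeff L O i (π l) = F.stepCoeff L O i l := by
  rcases lt_or_ge (l : ℕ) n₀ with hl | hl
  · rw [hπ l hl]
  · have hπl := le_perm_of_forall_lt hπ hl
    rw [T.stepCoeff_of_std (S.notMem_matchedCols_of_le hl) (S.std_beyond i l hl),
      T.stepCoeff_of_std (S.notMem_matchedCols_of_le hπl) (S.std_beyond i _ hπl)]

theorem meanCost_dualStep_permCols (S : MatchingState k n₀ F L) (T : F.Steppable L O)
    (hkm : k ≤ m) (hkn : k ≤ n) (hπ : ∀ l : Fin n, (l : ℕ) < n₀ → π l = l) (w : FinVar q m n) :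
    (F.dualStep L O (FinVar.permCols π w).emb).meanCost k n =
      (F.dualStep L O w.emb).meanCost k n := by
  have hne : ∀ {v}, v ≠ w → (FinVar.permCols π v).emb ≠ (FinVar.permCols π w).emb :=
    fun h => FinVar.emb_injective.ne ((FinVar.permCols π).injective.ne h)
  refine meanCost_permCols hkm hkn π (fun i l v => ?_) fun v => ?_ <;>
    rw [ExpFamily.dualStep, ExpFamily.dualStep] <;> by_cases h : v = w
  · rw [h, coeff_replace_self, coeff_replace_self, S.stepCoeff_perm T hπ]
  · rw [coeff_replace_of_ne F (hne h), coeff_replace_of_ne F (FinVar.emb_injective.ne h),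
      S.coeff_permCols hπ]
  · rw [h, rate_replace_self, rate_replace_self]
  · rw [rate_replace_of_ne F (hne h), rate_replace_of_ne F (FinVar.emb_injective.ne h),
      S.rate_permCols hπ]

theorem meanCost_dualStep_beyond (S : MatchingState k n₀ F L) (T : F.Steppable L O)
    (hkm : k ≤ m) (hkn : k ≤ n) {i : Fin m} {j : ℕ} (hj : n₀ ≤ j) (hjn : j < n) :
    (F.dualStep L O (Sum.inr (i, j))).meanCost k n =
      (F.dualStep L O (Sum.inr (i, n₀))).meanCost k n := by
  let a : Fin n := ⟨n₀, hj.trans_lt hjn⟩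
  have hπ : ∀ l : Fin n, (l : ℕ) < n₀ → Equiv.swap a ⟨j, hjn⟩ l = l := fun l hl =>
    Equiv.swap_apply_of_ne_of_ne (Fin.ne_of_val_ne hl.ne)
      (Fin.ne_of_val_ne (hl.trans_le hj).ne)
  have h := S.meanCost_dualStep_permCols T hkm hkn hπ (Sum.inr (i, a))
  rwa [show FinVar.permCols (Equiv.swap a ⟨j, hjn⟩) (Sum.inr (i, a)) = Sum.inr (i, ⟨j, hjn⟩) from
    congrArg (fun l => Sum.inr (i, l)) (Equiv.swap_apply_left a ⟨j, hjn⟩)] at h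

theorem sum_range_sdiff_matchedCols (S : MatchingState k n₀ F L) (hn : n₀ ≤ n) {g : ℕ → ℝ≥0∞}
    (hg : ∀ j, n₀ ≤ j → j < n → g j = g n₀) :
    ∑ j ∈ Finset.range n \ L.matchedCols, g j =
      ∑ j ∈ Finset.range n₀ \ L.matchedCols, g j + ((n - n₀ : ℕ) : ℝ≥0∞) * g n₀ := by
  have hsub : Finset.range n₀ \ L.matchedCols ⊆ Finset.range n \ L.matchedCols :=
    Finset.sdiff_subset_sdiff (Finset.range_mono hn) le_rfl
  have hrest : (Finset.range n \ L.matchedCols) \ (Finset.range n₀ \ L.matchedCols) =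
      Finset.Ico n₀ n := by
    ext j
    have := S.notMem_matchedCols_of_le (j := j)
    simp only [Finset.mem_sdiff, Finset.mem_range, Finset.mem_Ico]
    grind
  rw [← Finset.sum_sdiff hsub, hrest, add_comm, Finset.sum_congr rfl fun j hj =>
    hg j (Finset.mem_Ico.1 hj).1 (Finset.mem_Ico.1 hj).2, Finset.sum_const, Nat.card_Ico,
    nsmul_eq_mul]

theorem meanCost_eq_sum_stepTerm (S : MatchingState k n₀ F L) (T : F.Steppable L O)
    (hkm : k ≤ m) (hkn : k ≤ n) (hk : L.matched.card < k) (hm : L.reached.card < m)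
    (hn : n₀ ≤ n) :
    F.meanCost k n = ∑ w ∈ O, F.stepTerm k L O w n + ∑ i ∈ L.reachedᶜ,
      (∑ j ∈ Finset.range n₀ \ L.matchedCols, F.stepTerm k L O (Sum.inr (i, j)) n +
        ((n - n₀ : ℕ) : ℝ≥0∞) * F.stepTerm k L O (Sum.inr (i, n₀)) n) := by
  rw [S.meanCost_eq_sum_dualStep T hk hm hkm hkn hn,
    Finset.sum_union (S.disjoint_uncoveredVars T n), Labelling.uncoveredVars, Finset.sum_map,
    Finset.sum_product]
  refine congrArg _ (Finset.sum_congr rfl fun i _ => S.sum_range_sdiff_matchedCols hn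
    (g := fun j => F.stepTerm k L O (Sum.inr (i, j)) n) fun j hj hjn => ?_)
  rw [stepTerm, stepTerm, S.meanCost_dualStep_beyond T hkm hkn hj hjn, (S.std_beyond i j hj).rate,
    (S.std_beyond i n₀ le_rfl).rate]

theorem isRationalSeq_stepTerm (S : MatchingState k n₀ F L) (hk : L.matched.card < k)
    (hm : L.reached.card < m) {n₁ : ℕ} (hn₁ : k ≤ n₁) {w : Var q m}
    (h : IsRationalSeq k n₁ ((F.dualStep L O w).meanCost k)) :
    IsRationalSeq k n₁ (F.stepTerm k L O w) := by
  have hd : (0 : ℝ) < k - L.matched.card := sub_pos.2 (by exact_mod_cast hk)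
  have hrate := S.isKPositive_stepRate (O := O) hk hm
  exact (IsKPositive.isRationalSeq_div hn₁ (S.kpos w) hrate).mul <| h.add hn₁ <|
    IsKPositive.isRationalSeq_div hn₁ (f := fun _ => k - L.matched.card)
      ⟨⟨0, k - L.matched.card, fun x => by simp⟩, fun _ _ => hd⟩ hrate

theorem isRationalSeq_of_dualStep (S : MatchingState k n₀ F L) (T : F.Steppable L O)
    (hkm : k ≤ m) (hkn : k ≤ n₀) (hk : L.matched.card < k) (hm : L.reached.card < m)
    (hO : ∀ w ∈ O, IsRationalSeq k n₀ ((F.dualStep L O w).meanCost k))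
    (hU : ∀ i ∉ L.reached, ∀ j ∉ L.matchedCols, ∀ n₁, n₀ ≤ n₁ → j < n₁ →
      IsRationalSeq k n₁ ((F.dualStep L O (Sum.inr (i, j))).meanCost k)) :
    IsRationalSeq k n₀ (F.meanCost k) := by
  refine IsRationalSeq.congr ?_ fun n hn =>
    S.meanCost_eq_sum_stepTerm T hkm (hkn.trans hn) hk hm hn
  refine .add hkn (.sum hkn _ fun w hw => S.isRationalSeq_stepTerm hk hm hkn (hO w hw)) <|
    .sum hkn _ fun i hi => .add hkn (.sum hkn _ fun j hj => ?_) (.sub_mul ?_)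
  · rw [Finset.mem_sdiff, Finset.mem_range] at hj
    exact S.isRationalSeq_stepTerm hk hm hkn (hU i (Finset.mem_compl.1 hi) j hj.2 _ le_rfl hj.1)
  · exact S.isRationalSeq_stepTerm hk hm (hkn.trans n₀.le_succ) (hU i (Finset.mem_compl.1 hi) n₀
      (S.notMem_matchedCols_of_le le_rfl) _ n₀.le_succ n₀.lt_succ_self)

end MatchingState

end Exchangeability

section Recursion

variable {q m k n n₀ : ℕ} {F : ExpFamily q m} {L : Labelling m}

/-- `L'` has a larger matching than `L`, or a matching of the same size and more reached rows. -/
def Labelling.Progress (L L' : Labelling m) : Prop :=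
  L.matched.card < L'.matched.card ∨
    L'.matched.card = L.matched.card ∧ L.reached.card < L'.reached.card

/-- The induction hypothesis for `L`: every state that is a progress over `L` has a mean cost that
is rational in the number of columns. -/
def RationalAbove (q k : ℕ) (L : Labelling m) : Prop :=
  ∀ ⦃n₀ : ℕ⦄ ⦃F : ExpFamily q m⦄ ⦃L' : Labelling m⦄, k ≤ n₀ → L.Progress L' →
    MatchingState k n₀ F L' → IsRationalSeq k n₀ (F.meanCost k)

theorem ncard_setOf_emb_lt {P Q : Var q m → Prop} (hPQ : ∀ v, P v → Q v) {v : Var q m}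
    (hv : v.Below n) (hQ : Q v) (hP : ¬ P v) :
    {u : FinVar q m n | P u.emb}.ncard < {u : FinVar q m n | Q u.emb}.ncard := by
  obtain ⟨u, rfl⟩ := hv.exists_emb
  exact Set.ncard_lt_ncard ⟨fun _ => hPQ _, fun h => hP (h hQ)⟩

namespace ExpFamily

theorem coeff_dualStep_scale_of_ne {u v : Var q m} (h : u ≠ v) (a : ℝ) (i : Fin m) (j : ℕ) :
    ((F.scale v a).dualStep L {v} v).coeff i j u = F.coeff i j u :=
  (coeff_replace_of_ne _ h ..).trans (coeff_replace_of_ne F h ..)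

theorem coeff_dualStep_scale_self (v : Var q m) (a : ℝ) {i : Fin m} {j : ℕ} (hi : i ∉ L.reached)
    (hj : j ∈ L.matchedCols) (hj' : j ∉ L.coveredCols) :
    ((F.scale v a).dualStep L {v} v).coeff i j v = F.coeff i j v / a - 1 := by
  rw [dualStep, coeff_replace_self, stepCoeff, if_neg fun h => h.2 hj, if_neg hi, if_neg hj',
    Finset.sum_singleton, scale, coeff_replace_self]
  ring

theorem coeff_dualStep_scale_le {v : Var q m} {a i : Fin m} {b j : ℕ} (hv : 0 < F.coeff a b v)
    (hle : F.coeff a b ≤ F.coeff i j) (ha : a ∉ L.reached) (hb : b ∈ L.matchedCols)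
    (hb' : b ∉ L.coveredCols) (hi : i ∉ L.reached) (hj : j ∈ L.matchedCols)
    (hj' : j ∉ L.coveredCols) :
    ((F.scale v (F.coeff a b v)).dualStep L {v} v).coeff a b ≤
      ((F.scale v (F.coeff a b v)).dualStep L {v} v).coeff i j := by
  intro u
  by_cases hu : u = v
  · rw [hu, coeff_dualStep_scale_self v _ ha hb hb', coeff_dualStep_scale_self v _ hi hj hj']
    have := div_le_div_of_nonneg_right (hle v) hv.le
    linarith
  · rw [coeff_dualStep_scale_of_ne hu, coeff_dualStep_scale_of_ne hu]
    exact hle u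

theorem ncard_coeff_dualStep_scale_lt {v : Var q m} {a : Fin m} {b : ℕ}
    (hv : F.coeff a b v ≠ 0) (hvn : v.Below n) (ha : a ∉ L.reached) (hb : b ∈ L.matchedCols)
    (hb' : b ∉ L.coveredCols) :
    {u : FinVar q m n |
      ((F.scale v (F.coeff a b v)).dualStep L {v} v).coeff a b u.emb ≠ 0}.ncard <
      {u : FinVar q m n | F.coeff a b u.emb ≠ 0}.ncard := by
  have hself : ((F.scale v (F.coeff a b v)).dualStep L {v} v).coeff a b v = 0 := by
    rw [coeff_dualStep_scale_self v _ ha hb hb', div_self hv, sub_self]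
  refine ncard_setOf_emb_lt
    (P := fun u => ((F.scale v (F.coeff a b v)).dualStep L {v} v).coeff a b u ≠ 0)
    (Q := fun u => F.coeff a b u ≠ 0) (fun u hu => ?_) hvn hv (not_not.2 hself)
  rwa [coeff_dualStep_scale_of_ne fun e : u = v => hu (e ▸ hself)] at hu

/-- The difference of the coefficients at two positions. -/
def diff (F : ExpFamily q m) (p : (Fin m × ℕ) × (Fin m × ℕ)) (v : Var q m) : ℝ :=
  F.coeff p.1.1 p.1.2 v - F.coeff p.2.1 p.2.2 v

/-- The linear forms at two positions are comparable coefficientwise. -/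
def Comparable (F : ExpFamily q m) (p : (Fin m × ℕ) × (Fin m × ℕ)) : Prop :=
  (∀ v, 0 ≤ F.diff p v) ∨ ∀ v, F.diff p v ≤ 0

variable {p : (Fin m × ℕ) × (Fin m × ℕ)} {u v w : Var q m}

theorem diff_scale_self (v : Var q m) (a : ℝ) : (F.scale v a).diff p v = F.diff p v / a := by
  rw [diff, scale, coeff_replace_self, coeff_replace_self, diff, sub_div]

theorem diff_scale_of_ne (h : u ≠ v) (a : ℝ) : (F.scale v a).diff p u = F.diff p u := by
  rw [diff, scale, coeff_replace_of_ne F h, coeff_replace_of_ne F h, diff]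

theorem diff_conditionMin_self (V : Finset (Var q m)) (v : Var q m) :
    (F.conditionMin V v).diff p v = ∑ u ∈ V, F.diff p u := by
  rw [diff, conditionMin, coeff_replace_self, coeff_replace_self, ← Finset.sum_sub_distrib]
  rfl

theorem diff_conditionMin_of_ne (h : u ≠ v) (V : Finset (Var q m)) :
    (F.conditionMin V v).diff p u = F.diff p u := by
  rw [diff, conditionMin, coeff_replace_of_ne F h, coeff_replace_of_ne F h, diff]

theorem Comparable.scale (h : F.Comparable p) (v : Var q m) {a : ℝ} (ha : 0 < a) :
    (F.scale v a).Comparable p := by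
  refine h.imp (fun h u => ?_) fun h u => ?_ <;> by_cases hu : u = v
  · rw [hu, diff_scale_self]; exact div_nonneg (h v) ha.le
  · rw [diff_scale_of_ne hu]; exact h u
  · rw [hu, diff_scale_self]; exact div_nonpos_of_nonpos_of_nonneg (h v) ha.le
  · rw [diff_scale_of_ne hu]; exact h u

theorem Comparable.conditionMin (h : F.Comparable p) (V : Finset (Var q m)) (v : Var q m) :
    (F.conditionMin V v).Comparable p := by
  refine h.imp (fun h u => ?_) fun h u => ?_ <;> by_cases hu : u = v
  · rw [hu, diff_conditionMin_self]; exact Finset.sum_nonneg fun x _ => h x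
  · rw [diff_conditionMin_of_ne hu]; exact h u
  · rw [hu, diff_conditionMin_self]; exact Finset.sum_nonpos fun x _ => h x
  · rw [diff_conditionMin_of_ne hu]; exact h u

/-- Scale `v` so that the differences at `v` and `w`, if they have opposite signs, cancel, and
condition on the event that `u` is the smaller of `v` and `w`. -/
noncomputable def balance (F : ExpFamily q m) (p : (Fin m × ℕ) × (Fin m × ℕ)) (v w u : Var q m) :
    ExpFamily q m :=
  (F.scale v (-(F.diff p v / F.diff p w))).conditionMin {v, w} u

theorem ncard_diff_balance_lt (hv : 0 < F.diff p v) (hw : F.diff p w < 0) (hu : u = v ∨ u = w)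
    (hun : u.Below n) :
    {x : FinVar q m n | (F.balance p v w u).diff p x.emb ≠ 0}.ncard <
      {x : FinVar q m n | F.diff p x.emb ≠ 0}.ncard := by
  have hvw : w ≠ v := by rintro rfl; exact lt_asymm hv hw
  have hself : (F.balance p v w u).diff p u = 0 := by
    rw [balance, diff_conditionMin_self, Finset.sum_pair hvw.symm, diff_scale_self,
      diff_scale_of_ne hvw]
    have := hv.ne'
    have := hw.ne
    field_simp
    ring
  have hdiff_u : F.diff p u ≠ 0 := by
    rcases hu with rfl | rfl
    exacts [hv.ne', hw.ne]
  refine ncard_setOf_emb_lt (P := fun x => (F.balance p v w u).diff p x ≠ 0)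
    (Q := fun x => F.diff p x ≠ 0) (fun x hx => ?_) hun hdiff_u (not_not.2 hself)
  have hxu : x ≠ u := fun e => hx (e ▸ hself)
  by_cases hxv : x = v
  · exact hxv ▸ hv.ne'
  · rwa [balance, diff_conditionMin_of_ne hxu, diff_scale_of_ne hxv] at hx

end ExpFamily

namespace MatchingState

open ExpFamily

theorem isRationalSeq_of_zero (S : MatchingState k n₀ F L) (hkn : k ≤ n₀)
    (hL : RationalAbove q k L) {i : Fin m} {j : ℕ} (hi : i ∉ L.reached) (hj : j ∉ L.coveredCols)
    (h0 : F.coeff i j = 0) : IsRationalSeq k n₀ (F.meanCost k) := by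
  by_cases hiI : i ∈ L.matched
  · exact hL (L' := L.reach i) hkn (.inr ⟨rfl, Finset.card_lt_card (Finset.ssubset_insert hi)⟩)
      (S.reach hiI hi hj h0)
  · obtain ⟨τ, S'⟩ := S.exists_augment hiI hj h0
    exact hL hkn (.inl (Finset.card_lt_card (Finset.ssubset_insert hiI))) S'

theorem card_reached_lt (S : MatchingState k n₀ F L) (hkm : k ≤ m) (hk : L.matched.card < k) :
    L.reached.card < m :=
  (Finset.card_le_card S.subset).trans_lt (hk.trans_le hkm)

theorem isRationalSeq_of_one_le_sum (S : MatchingState k n₀ F L) (hkm : k ≤ m) (hkn : k ≤ n₀)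
    (hk : L.matched.card < k) (hL : RationalAbove q k L) {O : Finset (Var q m)}
    (hfree : ∀ v ∈ O, Free F L v)
    (hone : ∀ i j, i ∉ L.reached → j ∈ L.reachedCols → 1 ≤ ∑ v ∈ O, F.coeff i j v)
    (hO : F.Steppable L O → ∀ w ∈ O, IsRationalSeq k n₀ ((F.dualStep L O w).meanCost k)) :
    IsRationalSeq k n₀ (F.meanCost k) := by
  by_cases hzero : ∃ i j, i ∉ L.reached ∧ j ∉ L.coveredCols ∧ F.coeff i j = 0
  · obtain ⟨i, j, hi, hj, h0⟩ := hzero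
    exact S.isRationalSeq_of_zero hkn hL hi hj h0
  push Not at hzero
  have T : F.Steppable L O := ⟨hzero, hfree, hone⟩
  have hm := S.card_reached_lt hkm hk
  refine S.isRationalSeq_of_dualStep T hkm hkn hk hm (hO T) fun i hi j hj n₁ hn₁ hjn => ?_
  refine (S.dualStep T hk hm hn₁ ?_).isRationalSeq_of_zero (hkn.trans hn₁) hL hi
    (Labelling.notMem_coveredCols_of_notMem hj) (S.coeff_dualStep_eq_zero T hi hj)
  rintro a b hab
  exact (Prod.mk.inj (Sum.inr_injective hab)).2 ▸ hjn

theorem scale (S : MatchingState k n₀ F L) {v : Var q m} (hv : Free F L v) {a : ℝ} (ha : 0 < a) :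
    MatchingState k n₀ (F.scale v a) L :=
  S.replace le_rfl (Free.below S hv) (fun i j => div_nonneg (S.nonneg i j v) ha.le)
    ((S.kpos v).div_const ha) (fun i j h _ => by simp [h]) fun i j hj h => by
      rw [h.apply_eq_zero (hv i j hj h), zero_div]

theorem isRationalSeq_of_scale (S : MatchingState k n₀ F L) (hkn : k ≤ n₀) {v : Var q m}
    (hv : Free F L v) {a : ℝ} (ha : 0 < a) (h : IsRationalSeq k n₀ ((F.scale v a).meanCost k)) :
    IsRationalSeq k n₀ (F.meanCost k) :=
  h.congr fun n hn => (meanCost_scale ((Free.below S hv).mono hn)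
    ((S.kpos v).2 n (by exact_mod_cast hkn.trans hn)) ha).symm

theorem isRationalSeq_of_isLeast (S : MatchingState k n₀ F L) (hkm : k ≤ m) (hkn : k ≤ n₀)
    (hk : L.matched.card < k) (hL : RationalAbove q k L) {a : Fin m} {b : ℕ} (ha : a ∉ L.reached)
    (hb : b ∈ L.reachedCols)
    (hmin : ∀ i j, i ∉ L.reached → j ∈ L.reachedCols → F.coeff a b ≤ F.coeff i j) :
    IsRationalSeq k n₀ (F.meanCost k) := by
  induction hN : {v : FinVar q m n₀ | F.coeff a b v.emb ≠ 0}.ncard using Nat.strong_induction_on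
    generalizing F with
  | _ N ih =>
    by_cases h0 : F.coeff a b = 0
    · exact S.isRationalSeq_of_zero hkn hL ha (S.notMem_coveredCols_of_mem_reachedCols hb) h0
    obtain ⟨v, hv⟩ := Function.ne_iff.1 h0
    have hpos : 0 < F.coeff a b v := (S.nonneg a b v).lt_of_ne' hv
    have hbL := S.mem_matchedCols_of_mem_reachedCols hb
    have hbL' := S.notMem_coveredCols_of_mem_reachedCols hb
    have hfree : Free F L v := free_of_ne_zero hbL hv
    have S₁ := S.scale hfree hpos
    have hfree₁ : Free (F.scale v (F.coeff a b v)) L v := free_of_ne_zero (i := a) hbL <| by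
      rw [ExpFamily.scale, coeff_replace_self, div_self hv]
      exact one_ne_zero
    have hone : ∀ i j, i ∉ L.reached → j ∈ L.reachedCols →
        1 ≤ F.coeff i j v / F.coeff a b v := fun i j hi hj =>
      (one_le_div hpos).2 (hmin i j hi hj v)
    refine S.isRationalSeq_of_scale hkn hfree hpos <|
      S₁.isRationalSeq_of_one_le_sum hkm hkn hk hL (O := {v}) (by simpa using hfree₁)
        (fun i j hi hj => by simpa [ExpFamily.scale] using hone i j hi hj) fun T w hw => ?_
    obtain rfl := Finset.mem_singleton.1 hw
    refine ih _ ?_ (S₁.dualStep T hk (S.card_reached_lt hkm hk) le_rfl (Free.below S₁ hfree₁))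
      (fun i j hi hj => coeff_dualStep_scale_le hpos (hmin i j hi hj) ha hbL hbL' hi
        (S.mem_matchedCols_of_mem_reachedCols hj) (S.notMem_coveredCols_of_mem_reachedCols hj)) rfl
    exact hN ▸ ncard_coeff_dualStep_scale_lt hv (Free.below S hfree) ha hbL hbL'

theorem conditionMin (S : MatchingState k n₀ F L) {V : Finset (Var q m)}
    (hV : ∀ v ∈ V, Free F L v) {w : Var q m} (hw : w ∈ V) :
    MatchingState k n₀ (F.conditionMin V w) L :=
  S.replace le_rfl (Free.below S (hV w hw))
    (fun i j => Finset.sum_nonneg fun v _ => S.nonneg i j v)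
    (.sum ⟨w, hw⟩ fun v _ => S.kpos v) (fun i j h _ => by simp [h])
    fun i j hj h => Finset.sum_eq_zero fun v hv => h.apply_eq_zero (hV v hv i j hj h)

theorem isRationalSeq_of_conditionMin (S : MatchingState k n₀ F L) (hkn : k ≤ n₀)
    {V : Finset (Var q m)} (hV : V.Nonempty) (hfree : ∀ v ∈ V, Free F L v)
    (h : ∀ v ∈ V, IsRationalSeq k n₀ ((F.conditionMin V v).meanCost k)) :
    IsRationalSeq k n₀ (F.meanCost k) :=
  (IsRationalSeq.sum hkn V fun v hv => ((S.kpos v).isRationalSeq_div hkn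
    (.sum hV fun u _ => S.kpos u)).mul (h v hv)).congr fun n hn =>
      meanCost_eq_sum_conditionMin hV (fun v hv => (Free.below S (hfree v hv)).mono hn)
        fun v => (S.kpos v).2 n (by exact_mod_cast hkn.trans hn)

variable {p : (Fin m × ℕ) × (Fin m × ℕ)}

theorem free_of_diff_ne_zero (hp₁ : p.1.2 ∈ L.matchedCols) (hp₂ : p.2.2 ∈ L.matchedCols)
    {v : Var q m} (hv : F.diff p v ≠ 0) : Free F L v := by
  by_cases h : F.coeff p.1.1 p.1.2 v = 0
  · exact free_of_ne_zero (i := p.2.1) hp₂ fun h' => hv (by rw [diff, h, h', sub_self])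
  · exact free_of_ne_zero hp₁ h

theorem isRationalSeq_of_comparable_insert (S : MatchingState k n₀ F L) (hkn : k ≤ n₀)
    {Q : Finset ((Fin m × ℕ) × (Fin m × ℕ))} (hp₁ : p.1.2 ∈ L.matchedCols)
    (hp₂ : p.2.2 ∈ L.matchedCols)
    (H : ∀ F : ExpFamily q m, MatchingState k n₀ F L → F.Comparable p →
      (∀ p' ∈ Q, F.Comparable p') → IsRationalSeq k n₀ (F.meanCost k))
    (hQ : ∀ p' ∈ Q, F.Comparable p') : IsRationalSeq k n₀ (F.meanCost k) := by
  induction hN : {u : FinVar q m n₀ | F.diff p u.emb ≠ 0}.ncard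
    using Nat.strong_induction_on generalizing F with
  | _ N ih =>
    by_cases hcomp : F.Comparable p
    · exact H F S hcomp hQ
    rw [Comparable, not_or] at hcomp
    push Not at hcomp
    obtain ⟨⟨w, hw⟩, v, hv⟩ := hcomp
    have hvw : w ≠ v := by rintro rfl; exact lt_asymm hv hw
    have ha : 0 < -(F.diff p v / F.diff p w) := neg_pos.2 (div_neg_of_pos_of_neg hv hw)
    have hfv := free_of_diff_ne_zero hp₁ hp₂ hv.ne'
    have S₁ := S.scale hfv ha
    have hfree₁ : ∀ u ∈ ({v, w} : Finset (Var q m)),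
        Free (F.scale v (-(F.diff p v / F.diff p w))) L u := by
      simp only [Finset.mem_insert, Finset.mem_singleton]
      rintro u (rfl | rfl) <;> refine free_of_diff_ne_zero hp₁ hp₂ ?_
      · rw [diff_scale_self]
        exact div_ne_zero hv.ne' ha.ne'
      · rw [diff_scale_of_ne hvw]
        exact hw.ne
    refine S.isRationalSeq_of_scale hkn hfv ha <|
      S₁.isRationalSeq_of_conditionMin hkn (Finset.insert_nonempty _ _) hfree₁ fun u hu =>
        ih _ ?_ (S₁.conditionMin hfree₁ hu)
          (fun p' hp' => ((hQ p' hp').scale v ha).conditionMin _ u) rfl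
    rw [← hN]
    exact ncard_diff_balance_lt hv hw (by simpa using hu) (Free.below S₁ (hfree₁ u hu))

theorem isRationalSeq_of_comparable (S : MatchingState k n₀ F L) (hkn : k ≤ n₀)
    (Q : Finset ((Fin m × ℕ) × (Fin m × ℕ)))
    (hQL : ∀ p ∈ Q, p.1.2 ∈ L.matchedCols ∧ p.2.2 ∈ L.matchedCols)
    (H : ∀ F : ExpFamily q m, MatchingState k n₀ F L → (∀ p ∈ Q, F.Comparable p) →
      IsRationalSeq k n₀ (F.meanCost k)) : IsRationalSeq k n₀ (F.meanCost k) := by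
  classical
  induction Q using Finset.induction_on generalizing F with
  | empty => exact H F S (by simp)
  | insert p Q _ ih =>
    simp only [Finset.forall_mem_insert] at hQL H
    exact ih S hQL.2 fun F S hQ =>
      S.isRationalSeq_of_comparable_insert hkn hQL.1.1 hQL.1.2 (fun F S hp hQ => H F S ⟨hp, hQ⟩) hQ

theorem isRationalSeq_of_rationalAbove (S : MatchingState k n₀ F L) (hkm : k ≤ m) (hkn : k ≤ n₀)
    (hk : L.matched.card < k) (hL : RationalAbove q k L) : IsRationalSeq k n₀ (F.meanCost k) := by
  let N : Finset (Fin m × ℕ) := L.reachedᶜ ×ˢ L.reachedCols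
  have hN : ∀ {e}, e ∈ N ↔ e.1 ∉ L.reached ∧ e.2 ∈ L.reachedCols := by simp [N]
  refine S.isRationalSeq_of_comparable hkn (N ×ˢ N) (fun p hp => ?_) fun F S hQ => ?_
  · rw [Finset.mem_product, hN, hN] at hp
    exact ⟨S.mem_matchedCols_of_mem_reachedCols hp.1.2,
      S.mem_matchedCols_of_mem_reachedCols hp.2.2⟩
  rcases N.eq_empty_or_nonempty with hempty | hne
  · refine S.isRationalSeq_of_one_le_sum hkm hkn hk hL (O := ∅) (by simp) (fun i j hi hj => ?_)
      (by simp)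
    exact absurd (hN.2 ⟨hi, hj⟩ : (i, j) ∈ N) (hempty ▸ Finset.notMem_empty _)
  · obtain ⟨⟨a, b⟩, hab, hmin⟩ :=
      Finset.exists_minimalFor (fun e : Fin m × ℕ => F.coeff e.1 e.2) N hne
    refine S.isRationalSeq_of_isLeast hkm hkn hk hL (hN.1 hab).1 (hN.1 hab).2 fun i j hi hj => ?_
    have hij : (i, j) ∈ N := hN.2 ⟨hi, hj⟩
    rcases hQ ((a, b), (i, j)) (Finset.mem_product.2 ⟨hab, hij⟩) with h | h
    · exact hmin hij fun v => sub_nonneg.1 (h v)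
    · exact fun v => sub_nonpos.1 (h v)

theorem isRationalSeq {n₀ : ℕ} {F : ExpFamily q m} {L : Labelling m} (S : MatchingState k n₀ F L)
    (hkm : k ≤ m) (hkn : k ≤ n₀) : IsRationalSeq k n₀ (F.meanCost k) := by
  by_cases hk : L.matched.card < k
  · exact S.isRationalSeq_of_rationalAbove hkm hkn hk fun n₁ F' L' hn₁ hLL' S' =>
      isRationalSeq S' hkm hn₁
  · refine (isRationalSeq_const le_rfl).congr fun n hn => ?_
    rw [S.meanCost_eq_zero hn (not_lt.1 hk), ENNReal.ofReal_zero]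
termination_by (m - L.matched.card, m - L.reached.card)
decreasing_by
  have h₁ := card_finset_fin_le L'.matched
  have h₂ := card_finset_fin_le L'.reached
  rcases hLL' with h | h <;> simp only [Prod.lex_def] <;> omega

end MatchingState

end Recursion

section Cover

variable {m n n₀ : ℕ}

theorem IsOptimalCover.card_le_card_biUnion {Z : Set (Fin m × Fin n)} {R : Finset (Fin m)}
    {C : Finset (Fin n)} (h : IsOptimalCover Z R C) {A : Finset (Fin n)} (hA : A ⊆ C)
    {t : Fin n → Finset (Fin m)} (ht : ∀ i j, (i, j) ∈ Z → i ∈ t j) :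
    A.card ≤ (A.biUnion t).card := by
  have hcov : IsCover Z (R ∪ A.biUnion t) (C \ A) := by
    rintro ⟨i, j⟩ hij
    by_cases hi : i ∈ R
    · exact .inl (Finset.mem_union_left _ hi)
    by_cases hj : j ∈ A
    · exact .inl (Finset.mem_union_right _ (Finset.mem_biUnion.2 ⟨j, hj, ht i j hij⟩))
    · exact .inr (Finset.mem_sdiff.2 ⟨(h.1 _ hij).resolve_left hi, hj⟩)
  have hle := h.2 _ _ hcov
  have hunion := Finset.card_union_le R (A.biUnion t)
  rw [Finset.card_sdiff_of_subset hA] at hle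
  have := Finset.card_le_card hA
  omega

theorem IsOptimalCover.exists_matching {Z : Set (Fin m × Fin n)} {R : Finset (Fin m)}
    {C : Finset (Fin n)} (h : IsOptimalCover Z R C) :
    ∃ g : C → Fin m, Function.Injective g ∧ ∀ j : C, (g j, (j : Fin n)) ∈ Z := by
  classical
  let t : Fin n → Finset (Fin m) := fun j => {i | (i, j) ∈ Z}
  obtain ⟨g, hg, hgt⟩ := (Finset.all_card_le_biUnion_card_iff_exists_injective
    fun j : C => t j).1 fun A => by
      have := h.card_le_card_biUnion (A := A.map (.subtype _)) (t := t)
        (fun j hj => Finset.property_of_mem_map_subtype A hj) fun i j hij => by simp [t, hij]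
      rwa [Finset.card_map, Finset.map_eq_image, Finset.image_biUnion] at this
  exact ⟨g, hg, fun j => (Finset.mem_filter.1 (hgt j)).2⟩

variable {Z : Set (Fin m × Fin n₀)} {f : Fin n₀ ↪ Fin n} {R : Finset (Fin m)}

theorem isCover_image_iff {C : Finset (Fin n)} :
    IsCover (Prod.map id f '' Z) R C ↔ IsCover Z R (C.preimage f f.injective.injOn) := by
  rw [IsCover, Set.forall_mem_image]
  simp [IsCover]

theorem isCover_image_map_iff {C : Finset (Fin n₀)} :
    IsCover (Prod.map id f '' Z) R (C.map f) ↔ IsCover Z R C := by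
  rw [IsCover, Set.forall_mem_image]
  simp [IsCover]

theorem card_preimage_embedding_le (f : Fin n₀ ↪ Fin n) (C : Finset (Fin n)) :
    (C.preimage f f.injective.injOn).card ≤ C.card := by
  rw [← Finset.card_map f]
  exact Finset.card_le_card (Finset.map_subset_iff_subset_preimage.2 le_rfl)

theorem IsOptimalCover.preimage {C : Finset (Fin n)}
    (h : IsOptimalCover (Prod.map id f '' Z) R C) :
    IsOptimalCover Z R (C.preimage f f.injective.injOn) := by
  refine ⟨isCover_image_iff.1 h.1, fun R' C' hC' => ?_⟩
  have hle := h.2 _ _ (isCover_image_map_iff.2 hC')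
  rw [Finset.card_map] at hle
  exact (Nat.add_le_add_left (card_preimage_embedding_le f C) _).trans hle

theorem IsOptimalCover.map {C : Finset (Fin n₀)} (h : IsOptimalCover Z R C) :
    IsOptimalCover (Prod.map id f '' Z) R (C.map f) := by
  refine ⟨isCover_image_map_iff.2 h.1, fun R' C' hC' => ?_⟩
  rw [Finset.card_map]
  exact (h.2 _ _ (isCover_image_iff.1 hC')).trans
    (Nat.add_le_add_left (card_preimage_embedding_le f C') _)

theorem IsColumnMaximalOptimalCover.preimage {C : Finset (Fin n)}
    (h : IsColumnMaximalOptimalCover (Prod.map id f '' Z) R C) :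
    IsColumnMaximalOptimalCover Z R (C.preimage f f.injective.injOn) :=
  ⟨h.1.preimage, fun R' _ h' => Finset.map_subset_iff_subset_preimage.1 (h.2 R' _ h'.map)⟩

end Cover

namespace ExponentialRAP

variable {k m n : ℕ} {Ω : Type*} [MeasurableSpace Ω] {μ : Measure Ω} {P : ExponentialRAP k m n μ}
  {i : Fin m} {j : Fin n}

theorem coeffAt_val (l : Fin P.p) : P.coeffAt i j l = P.coeff i j l := by
  simp [coeffAt]

theorem lt_of_coeffAt_ne_zero {l : ℕ} (hl : P.coeffAt i j l ≠ 0) : l < P.p := by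
  by_contra h
  exact hl (dif_neg h)

theorem mem_zeros_iff : (i, j) ∈ P.zeros ↔ ∀ l, P.coeffAt i j l = 0 := by
  refine ⟨fun h l => ?_, fun h l => (coeffAt_val l).symm.trans (h l)⟩
  by_contra hl
  exact hl ((coeffAt_val ⟨l, lt_of_coeffAt_ne_zero hl⟩).trans (h _))

theorem IsStandardPosition.notMem_zeros (h : P.IsStandardPosition i j) : (i, j) ∉ P.zeros := by
  obtain ⟨l, -, hl, -⟩ := h
  exact fun hz => one_ne_zero (hl.symm.trans (hz l))

theorem ae_cost_nonneg (P : ExponentialRAP k m n μ) : ∀ᵐ ω ∂μ, 0 ≤ P.cost ω := by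
  have hX : ∀ᵐ ω ∂μ, ∀ l, 0 ≤ P.X l ω := ae_all_iff.2 fun l =>
    ae_of_ae_map (P.hasLaw l).aemeasurable <|
      (P.hasLaw l).map_eq ▸ ae_nonneg_expMeasure (P.intensity l)
  filter_upwards [hX] with ω hω
  exact minAssignmentSum_nonneg fun i j => Finset.sum_nonneg fun l _ =>
    mul_nonneg (Rat.cast_nonneg.2 (P.coeff i j l).2) (hω l)

theorem aemeasurable_cost (P : ExponentialRAP k m n μ) : AEMeasurable P.cost μ := by
  have hmeas : Measurable fun x : Fin P.p → ℝ => minAssignmentSum k fun (i : Fin m) (j : Fin n) =>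
      ∑ l, ((P.coeff i j l : ℚ) : ℝ) * x l :=
    measurable_minAssignmentSum fun i j => by fun_prop
  exact hmeas.comp_aemeasurable (aemeasurable_pi_lambda _ fun l => (P.hasLaw l).aemeasurable)

theorem integrable_cost_and_expectedCost_eq (P : ExponentialRAP k m n μ) {x : ℝ} (hx : 0 ≤ x)
    (h : ∫⁻ ω, ENNReal.ofReal (P.cost ω) ∂μ = ENNReal.ofReal x) :
    Integrable P.cost μ ∧ P.expectedCost = x := by
  have hmeas := P.aemeasurable_cost.aestronglyMeasurable
  refine ⟨⟨hmeas, ?_⟩, ?_⟩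
  · rw [hasFiniteIntegral_iff_ofReal P.ae_cost_nonneg, h]
    exact ENNReal.ofReal_lt_top
  · rw [expectedCost, integral_eq_lintegral_of_nonneg_ae P.ae_cost_nonneg hmeas, h,
      ENNReal.toReal_ofReal hx]

end ExponentialRAP

section Law

variable {Ω ι κ α : Type*} [Fintype ι] [Fintype κ] [MeasurableSpace Ω] {μ : Measure Ω}
  [IsProbabilityMeasure μ] {X : ι → Ω → ℝ} {r : ι → ℝ} {G : (α → ℝ) → ℝ≥0∞}

theorem lintegral_linearForms_comp (hX : iIndepFun X μ)
    (hlaw : ∀ l, HasLaw (X l) (expMeasure (r l)) μ) {ψ : κ → ι} (hψ : Function.Injective ψ)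
    {a : α → ι → ℝ} (ha : ∀ p, ∀ l ∉ Set.range ψ, a p l = 0) (hG : Measurable G) :
    ∫⁻ ω, G (fun p => ∑ l, a p l * X l ω) ∂μ =
      ∫⁻ z, G (fun p => ∑ v, a p (ψ v) * z v) ∂expPi fun v => r (ψ v) := by
  have hmap := (iIndepFun_iff_map_fun_eq_pi_map fun v => (hlaw (ψ v)).aemeasurable).1
    (hX.precomp hψ)
  simp only [(hlaw _).map_eq] at hmap
  have hmeas : Measurable fun z : κ → ℝ => G fun p => ∑ v, a p (ψ v) * z v :=
    hG.comp (measurable_pi_lambda _ fun p => by fun_prop)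
  rw [expPi, ← hmap, lintegral_map' hmeas.aemeasurable
    (aemeasurable_pi_lambda _ fun v => (hlaw (ψ v)).aemeasurable)]
  refine lintegral_congr fun ω => congrArg G (funext fun p => ?_)
  exact (Finset.sum_of_injOn ψ hψ.injOn (fun _ _ => Finset.mem_coe.2 (Finset.mem_univ _))
    (fun l _ hl => by rw [ha p l (by simpa using hl), zero_mul]) fun _ _ => rfl).symm

theorem lintegral_linearForms_expPi_subtype {s : κ → ℝ} (hs : ∀ v, 0 < s v) (b : α → κ → ℝ)
    {p : κ → Prop} [Fintype {v // p v}] (hb : ∀ x v, ¬ p v → b x v = 0) (hG : Measurable G) :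
    ∫⁻ y, G (fun x => ∑ v, b x v * y v) ∂expPi s =
      ∫⁻ z, G (fun x => ∑ v : {v // p v}, b x v * z v) ∂expPi fun v : {v // p v} => s v := by
  have := isProbabilityMeasure_expPi hs
  have := fun v => isProbabilityMeasure_expMeasure (hs v)
  exact lintegral_linearForms_comp (μ := expPi s) (X := fun v y => y v)
    (iIndepFun_pi (X := fun _ x => x) fun _ => aemeasurable_id)
    (fun v => (measurePreserving_eval (fun v => expMeasure (s v)) v).hasLaw)
    Subtype.val_injective (fun x v hv => hb x v (by simpa using hv)) hG

theorem lintegral_linearForms_eq (hX : iIndepFun X μ)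
    (hlaw : ∀ l, HasLaw (X l) (expMeasure (r l)) μ) {s : κ → ℝ} (hs : ∀ v, 0 < s v)
    {a : α → ι → ℝ} {b : α → κ → ℝ} {ψ : {v // ∃ p, b p v ≠ 0} → ι} (hψ : Function.Injective ψ)
    (hrate : ∀ v, r (ψ v) = s v) (hcoeff : ∀ p v, a p (ψ v) = b p v)
    (hrange : ∀ p, ∀ l ∉ Set.range ψ, a p l = 0) (hG : Measurable G) :
    ∫⁻ ω, G (fun p => ∑ l, a p l * X l ω) ∂μ = ∫⁻ y, G (fun p => ∑ v, b p v * y v) ∂expPi s := by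
  classical
  have := Fintype.ofFinite {v // ∃ p, b p v ≠ 0}
  rw [lintegral_linearForms_comp hX hlaw hψ hrange hG, lintegral_linearForms_expPi_subtype hs b
    (fun p v hv => not_not.1 (not_exists.1 hv p)) hG]
  simp only [hrate, hcoeff]

end Law

section Initial

variable {k m n n₀ : ℕ} {Ω : ℕ → Type*} [∀ n, MeasurableSpace (Ω n)] {μ : ∀ n, Measure (Ω n)}

/-- The labelling given by an injection from a set of columns to the rows. -/
noncomputable def Labelling.ofMatching {C : Finset (Fin n₀)} (g : C → Fin m) : Labelling m where
  matched := Finset.univ.image g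
  reached := ∅
  col := Function.extend g (fun j => ((j : Fin n₀) : ℕ)) 0

namespace RAPSequence

variable {S : RAPSequence k m n₀ μ} {C : Finset (Fin n₀)} {i : Fin m} {j : ℕ}

theorem mem_zeros_iff (S : RAPSequence k m n₀ μ) (h : n₀ ≤ n) {j : Fin n₀} :
    (i, Fin.castLE h j) ∈ (S.P n h).zeros ↔ (i, j) ∈ (S.P n₀ le_rfl).zeros := by
  simp only [ExponentialRAP.mem_zeros_iff, S.coeff_eq n h]

theorem zeros_eq_image (S : RAPSequence k m n₀ μ) (h : n₀ ≤ n) :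
    (S.P n h).zeros = Prod.map id (Fin.castLEEmb h) '' (S.P n₀ le_rfl).zeros := by
  ext ⟨i, j⟩
  constructor
  · intro hz
    have hj : (j : ℕ) < n₀ := by
      by_contra! hj
      exact (S.standard_beyond n h i j hj).notMem_zeros hz
    exact ⟨(i, ⟨j, hj⟩), (S.mem_zeros_iff h (j := ⟨j, hj⟩)).1 hz, rfl⟩
  · rintro ⟨⟨i', j'⟩, hz, he⟩
    exact he ▸ (S.mem_zeros_iff h).2 hz

/-- In every matrix of the sequence, the nonzero entries in those of the first `n₀` columns that do
not belong to `C` are standard. -/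
def StandardOutside (S : RAPSequence k m n₀ μ) (C : Finset (Fin n₀)) : Prop :=
  ∀ n (h : n₀ ≤ n) (i : Fin m) (j : Fin n₀), j ∉ C → (i, j) ∉ (S.P n₀ le_rfl).zeros →
    (S.P n h).IsStandardPosition i (Fin.castLE h j)

theorem WellBehaved.exists_isColumnMaximal (hS : S.WellBehaved) (h : n₀ ≤ n) {j : Fin n₀}
    (hz : (i, j) ∉ (S.P n₀ le_rfl).zeros)
    (hstd : ¬ (S.P n h).IsStandardPosition i (Fin.castLE h j)) :
    ∃ R C, IsColumnMaximalOptimalCover (S.P n₀ le_rfl).zeros R C ∧ j ∈ C := by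
  obtain ⟨R, C, hRC, hj⟩ := hS.nonstandard_covered n h i _ (mt (S.mem_zeros_iff h).1 hz) hstd
  rw [S.zeros_eq_image h] at hRC
  exact ⟨R, _, hRC.preimage, by simpa using hj⟩

theorem WellBehaved.exists_matching (hS : S.WellBehaved) :
    ∃ (C : Finset (Fin n₀)) (g : C → Fin m), Function.Injective g ∧
      (∀ j : C, (g j, (j : Fin n₀)) ∈ (S.P n₀ le_rfl).zeros) ∧ S.StandardOutside C := by
  by_cases hex : ∃ R C, IsColumnMaximalOptimalCover (S.P n₀ le_rfl).zeros R C
  · obtain ⟨R, C, hRC⟩ := hex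
    obtain ⟨g, hg, hgz⟩ := hRC.1.exists_matching
    refine ⟨C, g, hg, hgz, fun n h i j hj hz => ?_⟩
    by_contra hstd
    obtain ⟨R', C', hRC', hj'⟩ := hS.exists_isColumnMaximal h hz hstd
    exact hj (hRC.2 R' C' hRC'.1 hj')
  · refine ⟨∅, fun j => absurd j.2 (Finset.notMem_empty _),
      fun j => absurd j.2 (Finset.notMem_empty _),
      fun j => absurd j.2 (Finset.notMem_empty _), fun n h i j _ hz => ?_⟩
    by_contra hstd
    obtain ⟨R, C, hRC, -⟩ := hS.exists_isColumnMaximal h hz hstd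
    exact hex ⟨R, C, hRC⟩

/-- The entry at the position keeps its linear form from `S`, because it is zero or its column
belongs to `C`. The other entries are standard and get the variable of their position. -/
def Inherited (S : RAPSequence k m n₀ μ) (C : Finset (Fin n₀)) (i : Fin m) (j : ℕ) : Prop :=
  ∃ h : j < n₀, ⟨j, h⟩ ∈ C ∨ (i, ⟨j, h⟩) ∈ (S.P n₀ le_rfl).zeros

open Classical in
/-- The sequence as a family of matrices: a standard entry outside the columns in `C` is given by
the variable of its position, and the variables in the columns in `C` keep their indices. -/
noncomputable def WellBehaved.family (hS : S.WellBehaved) (C : Finset (Fin n₀)) :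
    ExpFamily (S.P n₀ le_rfl).p m where
  coeff i j := if h : S.Inherited C i j then
    Sum.elim (fun l => (((S.P n₀ le_rfl).coeff i ⟨j, h.1⟩ l : ℚ) : ℝ)) 0
    else Pi.single (Sum.inr (i, j)) 1
  rate := Sum.elim (fun l => if h : ∃ i j, (S.P n₀ le_rfl).coeffAt i j l ≠ 0 then
    (hS.intensity_linear l h).choose else fun _ => 1) fun _ _ => 1

section Family

variable (hS : S.WellBehaved)

theorem coeff_family_of_not_inherited (h : ¬ S.Inherited C i j) :
    (hS.family C).coeff i j = Pi.single (Sum.inr (i, j)) 1 :=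
  dif_neg h

theorem coeff_family_inl {l : Fin (S.P n₀ le_rfl).p} (h : S.Inherited C i j) :
    (hS.family C).coeff i j (Sum.inl l) = ((S.P n₀ le_rfl).coeff i ⟨j, h.1⟩ l : ℚ) :=
  congrFun (dif_pos h) (Sum.inl l)

theorem coeff_family_inr (h : S.Inherited C i j) (e : Fin m × ℕ) :
    (hS.family C).coeff i j (Sum.inr e) = 0 :=
  congrFun (dif_pos h) (Sum.inr e)

theorem eq_of_coeff_family_inr_ne_zero {e : Fin m × ℕ}
    (h : (hS.family C).coeff i j (Sum.inr e) ≠ 0) : ¬ S.Inherited C i j ∧ e = (i, j) := by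
  have hij : ¬ S.Inherited C i j := fun hij => h (coeff_family_inr hS hij e)
  refine ⟨hij, ?_⟩
  by_contra he
  rw [coeff_family_of_not_inherited hS hij, Pi.single_eq_of_ne (by simpa using he)] at h
  exact h rfl

theorem inherited_of_coeff_family_inl_ne_zero {l : Fin (S.P n₀ le_rfl).p}
    (h : (hS.family C).coeff i j (Sum.inl l) ≠ 0) : S.Inherited C i j := by
  by_contra hij
  exact h (by rw [coeff_family_of_not_inherited hS hij, Pi.single_eq_of_ne Sum.inl_ne_inr])

theorem coeff_family_eq_zero {j : Fin n₀} (hz : (i, j) ∈ (S.P n₀ le_rfl).zeros) :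
    (hS.family C).coeff i j = 0 := by
  have h : S.Inherited C i j := ⟨j.2, .inr hz⟩
  ext (l | e)
  · rw [coeff_family_inl hS h, show (S.P n₀ le_rfl).coeff i j l = 0 from hz l]
    exact Rat.cast_zero
  · exact coeff_family_inr hS h e

theorem coeff_family_nonneg (C : Finset (Fin n₀)) (i : Fin m) (j : ℕ)
    (v : Var (S.P n₀ le_rfl).p m) : 0 ≤ (hS.family C).coeff i j v := by
  by_cases h : S.Inherited C i j
  · rcases v with l | e
    · rw [coeff_family_inl hS h]
      exact Rat.cast_nonneg.2 ((S.P n₀ le_rfl).coeff i _ l).2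
    · exact (coeff_family_inr hS h e).ge
  · rw [coeff_family_of_not_inherited hS h]
    have hsingle : 0 ≤ (Pi.single (Sum.inr (i, j)) 1 : Var (S.P n₀ le_rfl).p m → ℝ) :=
      Pi.single_nonneg.2 zero_le_one
    exact hsingle v

theorem isKPositive_rate_family (C : Finset (Fin n₀)) (v : Var (S.P n₀ le_rfl).p m) :
    IsKPositive k ((hS.family C).rate v) := by
  rcases v with l | -
  · simp only [WellBehaved.family, Sum.elim_inl]
    split_ifs with h
    · exact (hS.intensity_linear l h).choose_spec.1
    · exact isKPositive_one
  · exact isKPositive_one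

theorem intensity_eq_rate_family (C : Finset (Fin n₀)) (h : n₀ ≤ n) {l : Fin (S.P n₀ le_rfl).p}
    (hused : ∃ i j, (S.P n₀ le_rfl).coeffAt i j l ≠ 0) (hl : (l : ℕ) < (S.P n h).p) :
    (S.P n h).intensity ⟨l, hl⟩ = (hS.family C).rate (Sum.inl l) n := by
  simp only [WellBehaved.family, Sum.elim_inl, dif_pos hused]
  exact (hS.intensity_linear l hused).choose_spec.2 n h hl

theorem isStd_family (h : ¬ S.Inherited C i j) : (hS.family C).IsStd i j where
  eq_single := coeff_family_of_not_inherited hS h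
  rate _ := rfl
  unique i' j' hne := by
    by_contra hc
    exact hne (eq_of_coeff_family_inr_ne_zero hS hc).2.symm

theorem matchingState {g : C → Fin m} (hg : Function.Injective g)
    (hgz : ∀ j : C, (g j, (j : Fin n₀)) ∈ (S.P n₀ le_rfl).zeros) :
    MatchingState k n₀ (hS.family C) (.ofMatching g) := by
  let L : Labelling m := .ofMatching g
  have hcol : ∀ j, L.col (g j) = ((j : Fin n₀) : ℕ) := fun j =>
    hg.extend_apply (fun j : C => ((j : Fin n₀) : ℕ)) 0 j
  have hmatched : ∀ i ∈ L.matched, ∃ j, g j = i := fun i hi => by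
    simpa [L, Labelling.ofMatching] using hi
  have hinj : Set.InjOn L.col L.matched := by
    intro a ha b hb hab
    obtain ⟨j, rfl⟩ := hmatched a ha
    obtain ⟨j', rfl⟩ := hmatched b hb
    rw [hcol, hcol] at hab
    rw [Subtype.ext (Fin.ext hab)]
  have hzero : ∀ i ∈ L.matched, (hS.family C).coeff i (L.col i) = 0 := by
    intro i hi
    obtain ⟨j, rfl⟩ := hmatched i hi
    rw [hcol]
    exact coeff_family_eq_zero hS (hgz j)
  refine ⟨coeff_family_nonneg hS C, isKPositive_rate_family hS C, Finset.empty_subset _, hinj,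
    hzero, fun i j hj => ?_, fun i j hj => isStd_family hS fun h => hj.not_gt h.1, fun j hj => ?_⟩
  · by_cases h : S.Inherited C i j
    · obtain ⟨hlt, hC | hz⟩ := h
      · exact absurd (Finset.mem_image.2 ⟨g ⟨_, hC⟩, Finset.mem_image_of_mem g (Finset.mem_univ _),
          hcol _⟩) hj
      · exact .inl (coeff_family_eq_zero hS hz)
    · exact .inr (isStd_family hS h)
  · refine ⟨L.col, .of_col hinj hzero ?_⟩
    rwa [Labelling.coveredCols, show (Labelling.ofMatching g).reached = ∅ from rfl,
      Finset.sdiff_empty] at hj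

end Family

end RAPSequence

end Initial

section Representation

namespace RAPSequence

variable {k m n n₀ : ℕ} {Ω : ℕ → Type*} [∀ n, MeasurableSpace (Ω n)] {μ : ∀ n, Measure (Ω n)}
  {S : RAPSequence k m n₀ μ} {C : Finset (Fin n₀)} {hS : S.WellBehaved} {h : n₀ ≤ n}
  {i : Fin m} {j : Fin n} {l l' : Fin (S.P n h).p} {v v' : FinVar (S.P n₀ le_rfl).p m n}

theorem StandardOutside.isStandardPosition (hout : S.StandardOutside C) (h : n₀ ≤ n)
    (hij : ¬ S.Inherited C i j) : (S.P n h).IsStandardPosition i j := by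
  by_cases hj : (j : ℕ) < n₀
  · exact hout n h i ⟨j, hj⟩ (fun hC => hij ⟨hj, .inl hC⟩) fun hz => hij ⟨hj, .inr hz⟩
  · exact S.standard_beyond n h i j (not_lt.1 hj)

theorem coeffAt_eq (S : RAPSequence k m n₀ μ) (h : n₀ ≤ n) (hj : (j : ℕ) < n₀) (l : ℕ) :
    (S.P n h).coeffAt i j l = (S.P n₀ le_rfl).coeffAt i ⟨j, hj⟩ l :=
  S.coeff_eq n h i ⟨j, hj⟩ l

variable (C hS) in
/-- The variable `l` of the matrix with `n` columns plays the part of the variable `v` of the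
family. -/
structure Represents (v : FinVar (S.P n₀ le_rfl).p m n) (l : Fin (S.P n h).p) : Prop where
  intensity_eq : (S.P n h).intensity l = (hS.family C).rate v.emb n
  coeff_eq : ∀ i j, (((S.P n h).coeff i j l : ℚ) : ℝ) = (hS.family C).coeff i j v.emb
  index_eq : ∀ l' : Fin (S.P n₀ le_rfl).p, v = Sum.inl l' → (l : ℕ) = l'

theorem represents_inr (hout : S.StandardOutside C) (hij : ¬ S.Inherited C i j)
    (hl : (S.P n h).coeff i j l ≠ 0) : Represents C hS (Sum.inr (i, j)) l := by
  obtain ⟨l₀, hrate, hone, hzero, hunique⟩ := hout.isStandardPosition h hij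
  obtain rfl : l = l₀ := of_not_not (mt (hzero l) hl)
  refine ⟨hrate, fun i' j' => ?_, fun _ => nofun⟩
  by_cases he : i' = i ∧ j' = j
  · obtain ⟨rfl, rfl⟩ := he
    rw [hone, coeff_family_of_not_inherited hS hij]
    exact (Rat.cast_one).trans (Pi.single_eq_same (M := fun _ => ℝ) _ _).symm
  · rw [of_not_not (mt (hunique i' j') he)]
    refine (Rat.cast_zero).trans (of_not_not fun hc => he ?_)
    obtain ⟨rfl, hj⟩ := Prod.ext_iff.1 (eq_of_coeff_family_inr_ne_zero hS (Ne.symm hc)).2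
    exact ⟨rfl, Fin.ext hj.symm⟩

theorem represents_inl (hout : S.StandardOutside C) (hij : S.Inherited C i j)
    (hl : (S.P n h).coeff i j l ≠ 0) (hlt : (l : ℕ) < (S.P n₀ le_rfl).p) :
    Represents C hS (Sum.inl ⟨l, hlt⟩) l := by
  have hused : ∃ i j, (S.P n₀ le_rfl).coeffAt i j l ≠ 0 :=
    ⟨i, _, by rwa [← S.coeffAt_eq h hij.1, ExponentialRAP.coeffAt_val]⟩
  refine ⟨intensity_eq_rate_family hS C h (l := ⟨l, hlt⟩) hused l.2, fun i' j' => ?_,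
    fun l' hl' => congrArg Fin.val (Sum.inl.inj hl')⟩
  by_cases hij' : S.Inherited C i' j'
  · refine .trans ?_ (coeff_family_inl hS hij').symm
    rw [← ExponentialRAP.coeffAt_val, S.coeffAt_eq h hij'.1,
      ← ExponentialRAP.coeffAt_val (P := S.P n₀ le_rfl), id]
  · obtain ⟨l₀, -, -, hzero, hunique⟩ := hout.isStandardPosition h hij'
    have hne : l ≠ l₀ := by
      rintro rfl
      obtain ⟨rfl, rfl⟩ := hunique i j hl
      exact hij' hij
    rw [hzero l hne]
    exact (Rat.cast_zero).trans (of_not_not fun hc =>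
      hij' (inherited_of_coeff_family_inl_ne_zero hS (Ne.symm hc)))

theorem exists_represents_left (hS : S.WellBehaved) (hout : S.StandardOutside C)
    (hl : (S.P n h).coeff i j l ≠ 0) : ∃ v, Represents C hS v l := by
  by_cases hij : S.Inherited C i j
  · rw [← ExponentialRAP.coeffAt_val, S.coeffAt_eq h hij.1] at hl
    refine ⟨_, represents_inl hout hij ?_ (ExponentialRAP.lt_of_coeffAt_ne_zero hl)⟩
    rwa [← ExponentialRAP.coeffAt_val, S.coeffAt_eq h hij.1]
  · exact ⟨_, represents_inr hout hij hl⟩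

theorem exists_represents_right (hout : S.StandardOutside C) (h : n₀ ≤ n)
    (hv : (hS.family C).coeff i j v.emb ≠ 0) : ∃ l : Fin (S.P n h).p, Represents C hS v l := by
  rcases v with l | ⟨i', j'⟩
  · have hij := inherited_of_coeff_family_inl_ne_zero hS hv
    rw [FinVar.emb, Sum.map_inl, id, coeff_family_inl hS hij, ← ExponentialRAP.coeffAt_val,
      ← S.coeffAt_eq h] at hv
    have hl : (S.P n h).coeffAt i j l ≠ 0 := by
      rintro h0
      exact hv (by rw [h0]; exact Rat.cast_zero)
    have hlt := ExponentialRAP.lt_of_coeffAt_ne_zero hl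
    exact ⟨⟨l, hlt⟩, represents_inl hout hij (l := ⟨l, hlt⟩)
      (by rwa [← ExponentialRAP.coeffAt_val]) l.2⟩
  · obtain ⟨hij, he⟩ := eq_of_coeff_family_inr_ne_zero hS hv
    obtain rfl : i' = i := congrArg Prod.fst he
    obtain rfl : j' = j := Fin.ext (congrArg Prod.snd he)
    obtain ⟨l, -, hone, -⟩ := hout.isStandardPosition h hij
    exact ⟨l, represents_inr hout hij (by rw [hone]; exact one_ne_zero)⟩

theorem Represents.left_unique (hl : Represents C hS v l) (hl' : Represents C hS v' l)
    (hv : (hS.family C).coeff i j v.emb ≠ 0) : v = v' := by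
  have hv' := hv
  rw [← hl.coeff_eq, hl'.coeff_eq] at hv'
  rcases v with a | a <;> rcases v' with b | b
  · exact congrArg _ (Fin.ext ((hl.index_eq a rfl).symm.trans (hl'.index_eq b rfl)))
  · exact absurd (inherited_of_coeff_family_inl_ne_zero hS hv)
      (eq_of_coeff_family_inr_ne_zero hS hv').1
  · exact absurd (inherited_of_coeff_family_inl_ne_zero hS hv')
      (eq_of_coeff_family_inr_ne_zero hS hv).1
  · have he := (eq_of_coeff_family_inr_ne_zero hS hv).2.trans
      (eq_of_coeff_family_inr_ne_zero hS hv').2.symm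
    exact congrArg Sum.inr (Function.injective_id.prodMap Fin.val_injective he)

theorem Represents.right_unique (hout : S.StandardOutside C) (hl : Represents C hS v l)
    (hl' : Represents C hS v l') (hv : (hS.family C).coeff i j v.emb ≠ 0) : l = l' := by
  rcases v with a | a
  · exact Fin.ext ((hl.index_eq a rfl).trans (hl'.index_eq a rfl).symm)
  · obtain ⟨l₀, -, -, hzero, -⟩ :=
      hout.isStandardPosition h (eq_of_coeff_family_inr_ne_zero hS hv).1
    have heq (x) (hx : Represents C hS (Sum.inr a) x) : x = l₀ := by
      by_contra hne
      rw [← hx.coeff_eq, hzero x hne] at hv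
      exact hv Rat.cast_zero
    rw [heq l hl, heq l' hl']

theorem exists_injective_represents (hout : S.StandardOutside C) (h : n₀ ≤ n) :
    ∃ ψ : {v : FinVar (S.P n₀ le_rfl).p m n // ∃ p : Fin m × Fin n,
        (hS.family C).coeff p.1 p.2 v.emb ≠ 0} → Fin (S.P n h).p,
      Function.Injective ψ ∧ (∀ v, Represents C hS v.1 (ψ v)) ∧
        ∀ i j, ∀ l ∉ Set.range ψ, (S.P n h).coeff i j l = 0 := by
  choose ψ hψ using fun v : {v : FinVar (S.P n₀ le_rfl).p m n // ∃ p : Fin m × Fin n,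
    (hS.family C).coeff p.1 p.2 v.emb ≠ 0} => exists_represents_right hout h v.2.choose_spec
  refine ⟨ψ, fun v v' hvv' => ?_, hψ, fun i j l hl => ?_⟩
  · exact Subtype.ext ((hψ v).left_unique (hvv' ▸ hψ v') v.2.choose_spec)
  · by_contra hne
    obtain ⟨v, hv⟩ := exists_represents_left hS hout hne
    have hij : (hS.family C).coeff i j v.emb ≠ 0 := by
      rw [← hv.coeff_eq]
      exact fun h0 => hne (by simpa using h0)
    exact hl ⟨⟨v, (i, j), hij⟩, (hψ ⟨v, (i, j), hij⟩).right_unique hout hv hij⟩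

theorem lintegral_cost_eq_meanCost [IsProbabilityMeasure (μ n)] (hS : S.WellBehaved)
    (hout : S.StandardOutside C) (h : n₀ ≤ n) :
    ∫⁻ ω, ENNReal.ofReal ((S.P n h).cost ω) ∂μ n = (hS.family C).meanCost k n := by
  have hpos (v : FinVar (S.P n₀ le_rfl).p m n) : 0 < (hS.family C).rate v.emb n :=
    (isKPositive_rate_family hS C v.emb).2 n (Nat.cast_le.2 (S.P n h).k_le_n)
  have hmeas : Measurable fun M : Fin m × Fin n → ℝ =>
      ENNReal.ofReal (minAssignmentSum k fun i j => M (i, j)) :=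
    (measurable_minAssignmentSum fun i j => measurable_pi_apply (i, j)).ennreal_ofReal
  obtain ⟨ψ, hinj, hψ, hrange⟩ := exists_injective_represents (hS := hS) hout h
  have hzero (p : Fin m × Fin n) (l) (hl : l ∉ Set.range ψ) :
      (((S.P n h).coeff p.1 p.2 l : ℚ) : ℝ) = 0 := by
    rw [hrange p.1 p.2 l hl]
    exact Rat.cast_zero
  have heq := lintegral_linearForms_eq (S.P n h).indep (S.P n h).hasLaw hpos
    (b := fun p v => (hS.family C).coeff p.1 p.2 v.emb) hinj (fun v => (hψ v).intensity_eq)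
    (fun p v => (hψ v).coeff_eq p.1 p.2) hzero hmeas
  exact heq

end RAPSequence

end Representation

theorem theoremT {k m n₀ : ℕ} {Ω : ℕ → Type*} [∀ n, MeasurableSpace (Ω n)]
    (μ : ∀ n, Measure (Ω n)) [∀ n, IsProbabilityMeasure (μ n)]
    (S : RAPSequence k m n₀ μ) (hS : S.WellBehaved) :
    ∃ f : RatFunc ℝ,
      (∀ z : ℂ, Polynomial.aeval z f.denom = 0 → z.im = 0 ∧ z.re < k) ∧
      ∀ n (h : n₀ ≤ n), Integrable (S.P n h).cost (μ n) ∧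
        (S.P n h).expectedCost = f.eval (RingHom.id ℝ) (n : ℝ) := by
  obtain ⟨hkm, hkn⟩ : k ≤ m ∧ k ≤ n₀ := ⟨(S.P n₀ le_rfl).k_le_m, (S.P n₀ le_rfl).k_le_n⟩
  obtain ⟨C, g, hg, hgz, hout⟩ := hS.exists_matching
  have hrat : IsRationalSeq k n₀ ((hS.family C).meanCost k) :=
    (RAPSequence.matchingState hS hg hgz).isRationalSeq hkm hkn
  obtain ⟨f, hroots, hf⟩ := hrat.exists_ratFunc hkn
  refine ⟨f, hroots, fun n h => ?_⟩
  obtain ⟨heval, hnonneg⟩ := hf n h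
  rw [← RAPSequence.lintegral_cost_eq_meanCost hS hout h] at heval
  exact (S.P n h).integrable_cost_and_expectedCost_eq hnonneg heval
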